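/- **Conventions.** For a C*-algebra $\mathfrak A$, $\mathfrak{sa}(\mathfrak A)$ is its self-adjoint part, $\mathscr S(\mathfrak A)$ its state space, $\mathfrak{uA}$ the smallest unital C*-algebra containing $\mathfrak A$ (so $\mathfrak{uA}=\mathfrak A$ if $\mathfrak A$ is unital), and $a\circ b=\frac{ab+ba}{2}$, $\{a,b\}=\frac{ab-ba}{2i}$. A *Lipschitz triple* $(\mathfrak A,\mathsf L,\mathfrak M)$ consists of a C*-algebra $\mathfrak A$, a seminorm $\mathsf L$ on a dense real subspace of $\mathfrak{sa}(\mathfrak{uA})$ with $\{\mathsf L=0\}=\mathbb R1$ (set $\mathsf L=\infty$ off its domain), and an Abelian C*-subalgebra $\mathfrak M$ of $\mathfrak A$ (the topography) containing an approximate unit of $\mathfrak A$; $\mathfrak M^\sigma$ is the Gel'fand spectrum of $\mathfrak M$. Put $\mathsf{mk}_{\mathsf L}(\varphi,\psi)=\sup\{|\varphi(a)-\psi(a)|:a\in\mathfrak{sa}(\mathfrak A),\mathsf L(a)\le1\}$ on states of $\mathfrak A$, and let $\mathsf{mk}^\sigma_{\mathsf L}$ be the same expression with $a$ restricted to $\mathfrak{sa}(\mathfrak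 M)$, for states of $\mathfrak M$. For $K\subseteq\mathfrak M^\sigma$ compact let $1_K\in\mathfrak M^{**}\subseteq\mathfrak A^{**}$ be its indicator projection, and $$\mathfrak L_{\mathfrak A}[K]=\{a\in\mathfrak{sa}(\mathfrak A):1_Ka1_K=a,\ \mathsf L(a)<\infty\},\qquad \mathscr S[\mathfrak A|K]=\{\varphi\in\mathscr S(\mathfrak A):\varphi(1_K)=1\}.$$ Let $\mathfrak L_{\mathfrak A}[\star]$ be the union of the $\mathfrak L_{\mathfrak A}[K]$ over all compact $K$. A set $S$ of states is *tame* if $\sup\{|\varphi(a-1_Ka1_K)|:\varphi\in S,a\in\mathfrak{sa}(\mathfrak A),\mathsf L(a)\le1\}\to0$ as $K$ increases through the compact subsets of $\mathfrak M^\sigma$. The triple is a *quantum locally compact metric space* if $\mathsf{mk}_{\mathsf L}$ metrizes the weak* topology on every tame set of states. It is a *proper quantum metric space* if moreover: $\mathfrak A$ is separable; $\mathsf L(a\circ b)$ and $\mathsf L(\{a,b\})$ are at most $\|a\|\mathsf L(b)+\mathsf L(a)\|b\|$ for $a,b\in\mathfrak{sa}(\mathfrak A)$; $\mathsf L$ is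 norm lower semicontinuous on $\mathfrak{sa}(\mathfrak A)$; $\mathfrak L_{\mathfrak A}[\star]$ is norm dense in $\{a\in\mathfrak{sa}(\mathfrak A):\mathsf L(a)<\infty\}$; $\mathfrak L_{\mathfrak A}[\star]\cap\mathfrak M$ is dense in $\mathfrak{sa}(\mathfrak M)$; and $(\mathfrak M^\sigma,\mathsf{mk}^\sigma_{\mathsf L})$ is a proper metric space. It is *pointed* by a choice of $\mu\in\mathfrak M^\sigma$; then $\mathfrak L_{\mathfrak A}[\mu,r]$ and $\mathscr S[\mathfrak A|\mu,r]$ denote $\mathfrak L_{\mathfrak A}[K]$ and $\mathscr S[\mathfrak A|K]$ for $K$ the closed $\mathsf{mk}^\sigma_{\mathsf L}$-ball of centre $\mu$ and radius $r$. A *passage* $\tau$ from $(\mathfrak A,\mathsf L_{\mathfrak A},\mathfrak M_{\mathfrak A},\mu_{\mathfrak A})$ to $(\mathfrak B,\mathsf L_{\mathfrak B},\mathfrak M_{\mathfrak B},\mu_{\mathfrak B})$, both pointed proper quantum metric spaces, is a quantum locally compact metric space $(\mathfrak D,\mathsf L_{\mathfrak D},\mathfrak M_{\mathfrak D})$ with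 $\mathsf L_{\mathfrak D}$ norm lower semicontinuous on $\mathfrak{sa}(\mathfrak D)$, and surjective *-morphisms $\pi_{\mathfrak A}:\mathfrak D\to\mathfrak A$, $\pi_{\mathfrak B}:\mathfrak D\to\mathfrak B$ which map $\mathfrak M_{\mathfrak D}$ into $\mathfrak M_{\mathfrak A}$, resp. $\mathfrak M_{\mathfrak B}$, and some approximate unit of $\mathfrak D$ in $\mathfrak M_{\mathfrak D}$ to an approximate unit. Its inverse $\tau^{-1}$ exchanges $\mathfrak A$ and $\mathfrak B$. For $a\in\mathfrak{sa}(\mathfrak A)$, $l\ge0$, $r,\varepsilon>0$ and $K\subseteq\mathfrak M_{\mathfrak D}^\sigma$ compact, the *lift set* and *target set* of $a$ are $$\mathfrak l_\tau(a|l,r,\varepsilon,K)=\{d\in\mathfrak L_{\mathfrak D}[K]:\pi_{\mathfrak A}(d)=a,\ \pi_{\mathfrak B}(d)\in\mathfrak L_{\mathfrak B}[\mu_{\mathfrak B},r+4\varepsilon],\ \mathsf L_{\mathfrak D}(d)\le l\},\qquad \mathfrak t_\tau(a|l,r,\varepsilon,K)=\pi_{\mathfrak B}\big(\mathfrak l_\tau(a|l,r,\varepsilon,K)\big).$$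 The pair $(\varepsilon,K)$ is *$r$-left admissible* for $\tau$ if: (i) $\psi\circ\pi_{\mathfrak A}\in\mathscr S[\mathfrak D|K]$ for all $\psi\in\mathscr S[\mathfrak A|\mu_{\mathfrak A},r]$; (ii) for every $\varphi\in\mathscr S[\mathfrak D|K]$ there is $\psi\in\mathscr S[\mathfrak A|\mu_{\mathfrak A},r+4\varepsilon]$ with $\mathsf{mk}_{\mathsf L_{\mathfrak D}}(\varphi,\psi\circ\pi_{\mathfrak A})\le\varepsilon$; (iii) $\mathfrak t_\tau(a|\mathsf L_{\mathfrak A}(a),r,\varepsilon,K)\ne\emptyset$ for all $a\in\mathfrak L_{\mathfrak A}[\mu_{\mathfrak A},r]$, and (iv) it meets $\mathfrak M_{\mathfrak B}$ if moreover $a\in\mathfrak M_{\mathfrak A}$; (v) $\mathsf L_{\mathfrak B}(\pi_{\mathfrak B}(d))\le\mathsf L_{\mathfrak D}(d)$ for all $d\in\mathfrak L_{\mathfrak D}[K]$. It is *$r$-admissible* for $\tau$ if it is $r$-left admissible for both $\tau$ and $\tau^{-1}$, $\mathsf{mk}^\sigma_{\mathsf L_{\mathfrak D}}(\mu_{\mathfrak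 A}\circ\pi_{\mathfrak A},\mu_{\mathfrak B}\circ\pi_{\mathfrak B})\le\varepsilon$, and $\mathsf L_{\mathfrak D}(d\circ d')$ and $\mathsf L_{\mathfrak D}(\{d,d'\})$ are at most $\mathsf L_{\mathfrak D}(d)\|d'\|+\mathsf L_{\mathfrak D}(d')\|d\|$ for all $d,d'\in\mathfrak L_{\mathfrak D}[K]$. The passage $\tau$ is an *$r$-tunnel* if there are $\varepsilon'>0$ and compact sets $K_t\subseteq\mathfrak M_{\mathfrak D}^\sigma$ ($0<t\le r$), increasing in $t$, with $(\varepsilon',K_t)$ $t$-admissible for every $t\in(0,r]$. **Theorem.** Let $r>0$, let $\tau$ be an $r$-tunnel from $(\mathfrak A,\mathsf L_{\mathfrak A},\mathfrak M_{\mathfrak A},\mu_{\mathfrak A})$ to $(\mathfrak B,\mathsf L_{\mathfrak B},\mathfrak M_{\mathfrak B},\mu_{\mathfrak B})$, let $l\ge0$, and let $(\varepsilon,K)$ be an $r$-admissible pair for $\tau$. Let $a,a'\in\mathfrak L_{\mathfrak A}[\mu_{\mathfrak A},r]$ with $\mathsf L_{\mathfrak A}(a)\le l$ and $\mathsf L_{\mathfrak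 A}(a')\le l$. Then: 1. $\|d\|_{\mathfrak D}\le\|a\|_{\mathfrak A}+l\varepsilon$ for all $d\in\mathfrak l_\tau(a|l,r,\varepsilon,K)$, and $\|b\|_{\mathfrak B}\le\|a\|_{\mathfrak A}+l\varepsilon$ for all $b\in\mathfrak t_\tau(a|l,r,\varepsilon,K)$. 2. For all $b\in\mathfrak t_\tau(a|l,r,\varepsilon,K)$, $b'\in\mathfrak t_\tau(a'|l,r,\varepsilon,K)$ and $t\in\mathbb R$: $\;b+tb'\in\mathfrak t_\tau(a+ta'|(1+|t|)l,r,\varepsilon,K)$. 3. $\sup\{\|b-b'\|_{\mathfrak B}:b\in\mathfrak t_\tau(a|l,r,\varepsilon,K),\ b'\in\mathfrak t_\tau(a'|l,r,\varepsilon,K)\}\le\|a-a'\|_{\mathfrak A}+2l\varepsilon$; in particular the norm diameter of $\mathfrak t_\tau(a|l,r,\varepsilon,K)$ is at most $2l\varepsilon$. 4. For all $b\in\mathfrak t_\tau(a|l,r,\varepsilon,K)$ and $b'\in\mathfrak t_\tau(a'|l,r,\varepsilon,K)$: $$b\circ b'\in\mathfrak t_\tau\big(a\circ a'\,\big|\,l(\|a\|_{\mathfrak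 A}+\|a'\|_{\mathfrak A}+2l\varepsilon),r,\varepsilon,K\big),\qquad \{b,b'\}\in\mathfrak t_\tau\big(\{a,a'\}\,\big|\,l(\|a\|_{\mathfrak A}+\|a'\|_{\mathfrak A}+2l\varepsilon),r,\varepsilon,K\big).$$ -/

import Mathlib

open Filter Topology
open scoped ENNReal MultiplierAlgebra

noncomputable section

/-! ### States, the bidual, and indicators of compact subsets of the topography -/

/-- The state space of a C⋆-algebra: positive linear functionals of norm one. -/
def stateSpace (A : Type*) [NonUnitalCStarAlgebra A] : Set (StrongDual ℂ A) :=
  {φ | ‖φ‖ = 1 ∧ ∀ a : A, 0 ≤ (φ (star a * a)).re ∧ (φ (star a * a)).im = 0}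

/-- The bidual `A**`. -/
abbrev Bidual (A : Type*) [NonUnitalCStarAlgebra A] : Type _ :=
  StrongDual ℂ (StrongDual ℂ A)

/-- The canonical embedding of `A` in `A**`. -/
def toBidual {A : Type*} [NonUnitalCStarAlgebra A] (a : A) : Bidual A :=
  NormedSpace.inclusionInDoubleDual ℂ A a

/-- The functional `G · f : a ↦ G (b ↦ f (a * b))`, as a continuous linear function of `f`. -/
def bidualAct {A : Type*} [NonUnitalCStarAlgebra A] (G : Bidual A) :
    StrongDual ℂ A →L[ℂ] StrongDual ℂ A :=
  (ContinuousLinearMap.compL ℂ A (StrongDual ℂ A) ℂ G).comp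
    (((ContinuousLinearMap.compL ℂ A (A →L[ℂ] A) (StrongDual ℂ A)).flip
      (ContinuousLinearMap.mul ℂ A)).comp (ContinuousLinearMap.compL ℂ A A ℂ))

theorem bidualAct_apply {A : Type*} [NonUnitalCStarAlgebra A] (G : Bidual A)
    (f : StrongDual ℂ A) (a : A) :
    bidualAct G f a = G (f.comp (ContinuousLinearMap.mul ℂ A a)) := rfl

/-- The (Arens) product of the enveloping von Neumann algebra `A**`:
`(F G) f = F (a ↦ G (b ↦ f (a * b)))`. -/
def bidualMul {A : Type*} [NonUnitalCStarAlgebra A] (F G : Bidual A) : Bidual A :=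
  F.comp (bidualAct G)

/-- For a set `K` of characters of `M`, the elements `m` of `M` with `0 ≤ m ≤ 1` whose Gel'fand
transform is equal to `1` on `K`. For `K` compact, this set, ordered by the order of `A`, is
directed downward and its Gel'fand transforms decrease to the indicator function of `K`. -/
def indicatorNet {A : Type*} [NonUnitalCStarAlgebra A] [PartialOrder A]
    (M : NonUnitalStarSubalgebra ℂ A) (K : Set (WeakDual.characterSpace ℂ M)) : Set A :=
  {m | 0 ≤ m ∧ ‖m‖ ≤ 1 ∧ ∃ h : m ∈ M, ∀ χ ∈ K, χ ⟨m, h⟩ = 1}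

/-- A bounded functional is eventually almost constant along `indicatorNet M K`. -/
theorem indicatorNet_cauchy {A : Type*} [NonUnitalCStarAlgebra A] [PartialOrder A]
    [StarOrderedRing A] (M : NonUnitalStarSubalgebra ℂ A)
    (K : Set (WeakDual.characterSpace ℂ M)) (m₀ : indicatorNet M K) (f : StrongDual ℂ A)
    {ε : ℝ} (hε : 0 < ε) :
    ∃ m₁ : indicatorNet M K, ∀ m ≤ m₁, ‖f (m : A) - f (m₁ : A)‖ < ε := by
  by_contra! hcon
  choose next hle hbig using hcon
  let s : ℕ → indicatorNet M K := fun n => next^[n] m₀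
  have hs : ∀ n, s (n + 1) = next (s n) := fun n => Function.iterate_succ_apply' _ _ _
  let d : ℕ → A := fun n => (s n : A) - (s (n + 1) : A)
  have hd : ∀ n, 0 ≤ d n := fun n => by
    have h1 : s (n + 1) ≤ s n := by rw [hs]; exact hle _
    exact sub_nonneg.2 h1
  have hsum : ∀ N, ∑ i ∈ Finset.range N, d i ≤ (s 0 : A) := fun N => by
    rw [Finset.sum_range_sub']
    exact sub_le_self _ (s N).2.1
  have hfin : ∀ N, ∀ I ⊆ Finset.range N, ‖∑ i ∈ I, d i‖ ≤ 1 := fun N I hI => by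
    refine (CStarAlgebra.norm_le_norm_of_nonneg_of_le (Finset.sum_nonneg fun i _ => hd i)
      ((Finset.sum_le_sum_of_subset_of_nonneg hI fun i _ _ => hd i).trans (hsum N))).trans
      (s 0).2.2.1
  have hb : ∀ N, ∀ I ⊆ Finset.range N, ‖∑ i ∈ I, f (d i)‖ ≤ ‖f‖ := fun N I hI => by
    rw [← map_sum]
    refine (f.le_opNorm _).trans ?_
    calc ‖f‖ * ‖∑ i ∈ I, d i‖ ≤ ‖f‖ * 1 :=
          mul_le_mul_of_nonneg_left (hfin N I hI) (norm_nonneg _)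
      _ = ‖f‖ := mul_one _
  have habs : ∀ u : ℕ → ℝ, (∀ N, ∀ I ⊆ Finset.range N, |∑ i ∈ I, u i| ≤ ‖f‖) →
      ∀ N, ∑ i ∈ Finset.range N, |u i| ≤ 2 * ‖f‖ := fun u hu N => by
    rw [← Finset.sum_filter_add_sum_filter_not (Finset.range N) (fun i => 0 ≤ u i)]
    have h1 : ∑ i ∈ (Finset.range N).filter (fun i => 0 ≤ u i), |u i| ≤ ‖f‖ := by
      rw [Finset.sum_congr rfl fun i hi => abs_of_nonneg (Finset.mem_filter.1 hi).2]
      exact (le_abs_self _).trans (hu N _ (Finset.filter_subset _ _))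
    have h2 : ∑ i ∈ (Finset.range N).filter (fun i => ¬ 0 ≤ u i), |u i| ≤ ‖f‖ := by
      rw [Finset.sum_congr rfl fun i hi => abs_of_neg (not_le.1 (Finset.mem_filter.1 hi).2),
        Finset.sum_neg_distrib]
      exact (neg_le_abs _).trans (hu N _ (Finset.filter_subset _ _))
    linarith
  have hre := habs (fun i => (f (d i)).re) fun N I hI => by
    rw [← Complex.re_sum]
    exact (Complex.abs_re_le_norm _).trans (hb N I hI)
  have him := habs (fun i => (f (d i)).im) fun N I hI => by
    rw [← Complex.im_sum]
    exact (Complex.abs_im_le_norm _).trans (hb N I hI)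
  have hlow : ∀ N : ℕ, N * ε ≤ 4 * ‖f‖ := fun N => by
    have h1 : ∑ _i ∈ Finset.range N, ε ≤
        ∑ i ∈ Finset.range N, (|(f (d i)).re| + |(f (d i)).im|) := by
      refine Finset.sum_le_sum fun i _ => ?_
      refine le_trans ?_ (Complex.norm_le_abs_re_add_abs_im _)
      have h2 := hbig (s i)
      rw [← hs, norm_sub_rev, ← map_sub] at h2
      exact h2
    rw [Finset.sum_const, Finset.card_range, nsmul_eq_mul, Finset.sum_add_distrib] at h1
    linarith [hre N, him N]
  obtain ⟨N, hN⟩ := exists_nat_gt (4 * ‖f‖ / ε)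
  rw [div_lt_iff₀ hε] at hN
  linarith [hlow N]

/-- The net `indicatorNet M K` converges weak* in `A**`. -/
theorem exists_indicator {A : Type*} [NonUnitalCStarAlgebra A] [PartialOrder A]
    [StarOrderedRing A] (M : NonUnitalStarSubalgebra ℂ A)
    (K : Set (WeakDual.characterSpace ℂ M)) :
    ∃ p : Bidual A, ∀ f : StrongDual ℂ A,
      Tendsto (fun m : indicatorNet M K => f (m : A)) atBot (𝓝 (p f)) := by
  by_cases hbot : (atBot : Filter (indicatorNet M K)) = ⊥
  · exact ⟨0, fun f => by rw [hbot]; exact tendsto_bot⟩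
  have : (atBot : Filter (indicatorNet M K)).NeBot := ⟨hbot⟩
  obtain ⟨m₀⟩ : Nonempty (indicatorNet M K) := Filter.nonempty_of_neBot atBot
  have hlim : ∀ f : StrongDual ℂ A, ∃ z : ℂ,
      Tendsto (fun m : indicatorNet M K => f (m : A)) atBot (𝓝 z) := fun f => by
    refine cauchy_map_iff_exists_tendsto.1 (Metric.cauchy_iff.2 ⟨inferInstance, fun ε hε => ?_⟩)
    obtain ⟨m₁, h₁⟩ := indicatorNet_cauchy M K m₀ f (half_pos hε)
    refine ⟨_, image_mem_map (Iic_mem_atBot m₁), ?_⟩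
    rintro _ ⟨x, hx, rfl⟩ _ ⟨y, hy, rfl⟩
    have hx' := h₁ x hx
    have hy' := h₁ y hy
    rw [← dist_eq_norm] at hx' hy'
    linarith [dist_triangle_right (f (x : A)) (f (y : A)) (f (m₁ : A))]
  choose g hg using hlim
  let q : StrongDual ℂ A →ₗ[ℂ] ℂ :=
    { toFun := g
      map_add' := fun f f' => tendsto_nhds_unique (hg (f + f')) ((hg f).add (hg f'))
      map_smul' := fun c f => tendsto_nhds_unique (hg (c • f)) ((hg f).const_smul c) }
  refine ⟨q.mkContinuous 1 fun f => ?_, hg⟩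
  rw [one_mul]
  refine le_of_tendsto (hg f).norm (Eventually.of_forall fun m => ?_)
  refine (f.le_opNorm _).trans ?_
  calc ‖f‖ * ‖(m : A)‖ ≤ ‖f‖ * 1 := mul_le_mul_of_nonneg_left m.2.2.1 (norm_nonneg _)
    _ = ‖f‖ := mul_one _

/-- The indicator function of a compact `K ⊆ M^σ`, as a projection of `M** ⊆ A**`: the weak* limit
(infimum) of the functions in `M` lying between the indicator of `K` and `1`. -/
def indicator {A : Type*} [NonUnitalCStarAlgebra A] [PartialOrder A] [StarOrderedRing A]
    (M : NonUnitalStarSubalgebra ℂ A) (K : Set (WeakDual.characterSpace ℂ M)) : Bidual A :=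
  (exists_indicator M K).choose

theorem tendsto_indicator {A : Type*} [NonUnitalCStarAlgebra A] [PartialOrder A]
    [StarOrderedRing A] (M : NonUnitalStarSubalgebra ℂ A)
    (K : Set (WeakDual.characterSpace ℂ M)) (f : StrongDual ℂ A) :
    Tendsto (fun m : indicatorNet M K => f (m : A)) atBot (𝓝 (indicator M K f)) :=
  (exists_indicator M K).choose_spec f

/-- The compression `[a]_K = 1_K a 1_K`, an element of `A**`. -/
def corner {A : Type*} [NonUnitalCStarAlgebra A] [PartialOrder A] [StarOrderedRing A]
    (M : NonUnitalStarSubalgebra ℂ A) (K : Set (WeakDual.characterSpace ℂ M)) (a : A) :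
    Bidual A :=
  bidualMul (bidualMul (indicator M K) (toBidual a)) (indicator M K)

/-- The self-adjoint elements of `A` lying in the corner `1_K A 1_K`. -/
def localSA {A : Type*} [NonUnitalCStarAlgebra A] [PartialOrder A] [StarOrderedRing A]
    (M : NonUnitalStarSubalgebra ℂ A) (K : Set (WeakDual.characterSpace ℂ M)) : Set A :=
  {a | IsSelfAdjoint a ∧ corner M K a = toBidual a}

/-- The states `φ` of `A` with `φ(1_K) = 1`. -/
def localStates {A : Type*} [NonUnitalCStarAlgebra A] [PartialOrder A] [StarOrderedRing A]
    (M : NonUnitalStarSubalgebra ℂ A) (K : Set (WeakDual.characterSpace ℂ M)) :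
    Set (StrongDual ℂ A) :=
  {φ | φ ∈ stateSpace A ∧ indicator M K φ = 1}

/-- The Jordan product `(ab + ba) / 2`. -/
def jordanProd {A : Type*} [NonUnitalCStarAlgebra A] (a b : A) : A :=
  (1 / 2 : ℂ) • (a * b + b * a)

/-- The Lie product `(ab - ba) / (2i)`. -/
def lieProd {A : Type*} [NonUnitalCStarAlgebra A] (a b : A) : A :=
  (1 / (2 * Complex.I) : ℂ) • (a * b - b * a)

/-! ### Lipschitz pairs, Lipschitz triples, quantum locally compact metric spaces -/

/-- The self-adjoint part of the smallest unital C⋆-algebra `uA = A + ℂ1` containing `A`, realized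
inside the multiplier algebra of `A`. It is the image of `A` itself when `A` has a unit, and a copy
of the usual unitization otherwise. -/
def unitalSA (A : Type*) [NonUnitalCStarAlgebra A] : Set 𝓜(ℂ, A) :=
  {x | IsSelfAdjoint x ∧ ∃ (a : A) (z : ℂ), x = (a : 𝓜(ℂ, A)) + algebraMap ℂ 𝓜(ℂ, A) z}

/-- A Lipschitz pair `(A, L)`: a seminorm `L` on a dense real subspace of the self-adjoint part of
`uA`, whose kernel is `ℝ1`. The seminorm is given the value `∞` outside of its domain. -/
structure LipschitzPair (A : Type*) [NonUnitalCStarAlgebra A] where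
  /-- the extended seminorm -/
  L : 𝓜(ℂ, A) → ℝ≥0∞
  mem_of_lt_top : ∀ x, L x < ⊤ → x ∈ unitalSA A
  dense_dom : unitalSA A ⊆ closure {x | L x < ⊤}
  add_le : ∀ x y, L (x + y) ≤ L x + L y
  smul_eq : ∀ (t : ℝ) (x : 𝓜(ℂ, A)), L ((t : ℂ) • x) = ENNReal.ofReal |t| * L x
  eq_zero_iff : ∀ x, L x = 0 ↔ ∃ t : ℝ, x = algebraMap ℂ 𝓜(ℂ, A) (t : ℂ)

/-- The value of the Lip-norm at an element of `A` (it is `∞` at elements outside of the domain). -/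
def LipschitzPair.lip {A : Type*} [NonUnitalCStarAlgebra A] (T : LipschitzPair A) (a : A) : ℝ≥0∞ :=
  T.L (a : 𝓜(ℂ, A))

/-- The Monge-Kantorovich extended metric (on functionals on `A`). -/
def LipschitzPair.mkDist {A : Type*} [NonUnitalCStarAlgebra A] (T : LipschitzPair A)
    (φ ψ : StrongDual ℂ A) : ℝ≥0∞ :=
  ⨆ (a : A) (_ : IsSelfAdjoint a ∧ T.lip a ≤ 1), ENNReal.ofReal ‖φ a - ψ a‖

/-- `(A, L)` is a Leibniz Lipschitz pair. -/
def LipschitzPair.IsLeibniz {A : Type*} [NonUnitalCStarAlgebra A] (T : LipschitzPair A) : Prop :=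
  ∀ a b : A, IsSelfAdjoint a → IsSelfAdjoint b →
    T.lip (jordanProd a b) ≤ ENNReal.ofReal ‖a‖ * T.lip b + T.lip a * ENNReal.ofReal ‖b‖ ∧
    T.lip (lieProd a b) ≤ ENNReal.ofReal ‖a‖ * T.lip b + T.lip a * ENNReal.ofReal ‖b‖

/-- `M` is a topography on `A`: an Abelian C⋆-subalgebra containing an approximate unit of `A`. -/
structure IsTopography {A : Type*} [NonUnitalCStarAlgebra A] (M : NonUnitalStarSubalgebra ℂ A) :
    Prop where
  isClosed : IsClosed (M : Set A)
  comm : ∀ a ∈ M, ∀ b ∈ M, a * b = b * a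
  approx : ∃ l : Filter A, l.IsApproximateUnit ∧ (M : Set A) ∈ l

/-- A Lipschitz triple `(A, L, M)`. -/
structure LipschitzTriple (A : Type*) [NonUnitalCStarAlgebra A] extends LipschitzPair A where
  /-- the topography -/
  M : NonUnitalStarSubalgebra ℂ A
  topography : IsTopography M

namespace LipschitzTriple

variable {A : Type*} [NonUnitalCStarAlgebra A]

/-- The Gel'fand spectrum of the topography. -/
abbrev Spec (T : LipschitzTriple A) : Type _ := WeakDual.characterSpace ℂ T.M

/-- The Monge-Kantorovich extended metric of the restriction of `L` to the topography
(on functionals on `M`). -/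
def specDist (T : LipschitzTriple A) (f g : T.M → ℂ) : ℝ≥0∞ :=
  ⨆ (m : T.M) (_ : IsSelfAdjoint (m : A) ∧ T.lip (m : A) ≤ 1), ENNReal.ofReal ‖f m - g m‖

/-- The closed ball of `M^σ` for the Monge-Kantorovich metric of the topography. -/
def specBall (T : LipschitzTriple A) (μ : T.Spec) (r : ℝ) : Set T.Spec :=
  {χ | T.specDist χ μ ≤ ENNReal.ofReal r}

variable [PartialOrder A] [StarOrderedRing A]

/-- The Lipschitz elements supported on `K`. -/
def lipLoc (T : LipschitzTriple A) (K : Set T.Spec) : Set A :=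
  {a | a ∈ localSA T.M K ∧ T.lip a < ⊤}

/-- The Lipschitz, locally supported elements. -/
def lipLocStar (T : LipschitzTriple A) : Set A :=
  ⋃ K : TopologicalSpace.Compacts T.Spec, T.lipLoc K

/-- Tame sets of states: `φ(a - [a]_K)` tends to `0` as `K` ranges over the compact subsets of `M^σ`
(directed by inclusion), uniformly in `φ ∈ S` and in `a` self-adjoint with `L(a) ≤ 1`. -/
def IsTame (T : LipschitzTriple A) (S : Set (StrongDual ℂ A)) : Prop :=
  S ⊆ stateSpace A ∧
    Tendsto (fun K : TopologicalSpace.Compacts T.Spec =>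
      ⨆ (φ : StrongDual ℂ A) (_ : φ ∈ S) (a : A) (_ : IsSelfAdjoint a ∧ T.lip a ≤ 1),
        ENNReal.ofReal ‖φ a - corner T.M (K : Set T.Spec) a φ‖) atTop (𝓝 0)

/-- `(A, L, M)` is a quantum locally compact metric space: on each tame set of states the
Monge-Kantorovich metric induces the weak* topology. -/
def IsQuantumLocallyCompact (T : LipschitzTriple A) : Prop :=
  ∀ S : Set (StrongDual ℂ A), T.IsTame S → ∀ φ ∈ S,
    (𝓝[StrongDual.toWeakDual '' S] (StrongDual.toWeakDual φ)).HasBasis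
      (fun ε : ℝ≥0∞ => 0 < ε)
      (fun ε => StrongDual.toWeakDual '' {ψ | ψ ∈ S ∧ T.mkDist φ ψ < ε})

/-- `(A, L, M)` is a proper quantum metric space. -/
structure IsProperQuantum (T : LipschitzTriple A) : Prop where
  quantumLocallyCompact : T.IsQuantumLocallyCompact
  separable : TopologicalSpace.SeparableSpace A
  leibniz : T.IsLeibniz
  lsc : LowerSemicontinuousOn T.lip {a | IsSelfAdjoint a}
  dense_lipLocStar : {a | IsSelfAdjoint a ∧ T.lip a < ⊤} ⊆ closure T.lipLocStar
  dense_topography : {a | IsSelfAdjoint a ∧ a ∈ T.M} ⊆ closure (T.lipLocStar ∩ (T.M : Set A))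
  /-- the Monge-Kantorovich metric makes `M^σ` a proper metric space -/
  proper : ∃ m : MetricSpace T.Spec, (∀ χ η : T.Spec, m.edist χ η = T.specDist χ η) ∧
    @ProperSpace T.Spec m.toPseudoMetricSpace

end LipschitzTriple

/-- A pointed proper quantum metric space `(A, L, M, μ)`. -/
structure PointedProperQMS (A : Type*) [NonUnitalCStarAlgebra A] [PartialOrder A]
    [StarOrderedRing A] extends LipschitzTriple A where
  isProper : toLipschitzTriple.IsProperQuantum
  /-- the base point -/
  base : WeakDual.characterSpace ℂ M

namespace PointedProperQMS

variable {A : Type*} [NonUnitalCStarAlgebra A] [PartialOrder A] [StarOrderedRing A]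

/-- The Lipschitz elements supported on the closed ball of radius `r` around the base point. -/
def lipBall (X : PointedProperQMS A) (r : ℝ) : Set A :=
  X.lipLoc (X.specBall X.base r)

/-- The states supported on the closed ball of radius `r` around the base point. -/
def stateBall (X : PointedProperQMS A) (r : ℝ) : Set (StrongDual ℂ A) :=
  localStates X.M (X.specBall X.base r)

end PointedProperQMS

/-! ### Passages and tunnels -/

/-- Topographic morphisms. -/
structure IsTopographicMorphism {A B : Type*} [NonUnitalCStarAlgebra A] [NonUnitalCStarAlgebra B]
    (M : NonUnitalStarSubalgebra ℂ A) (N : NonUnitalStarSubalgebra ℂ B) (π : A →⋆ₙₐ[ℂ] B) :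
    Prop where
  surjective : Function.Surjective π
  map_mem : ∀ m ∈ M, π m ∈ N
  approx : ∃ l : Filter A, l.IsApproximateUnit ∧ (M : Set A) ∈ l ∧ (l.map π).IsApproximateUnit

/-- The dual map `φ ↦ φ ∘ π`. -/
def pullback {A B : Type*} [NonUnitalCStarAlgebra A] [NonUnitalCStarAlgebra B] (π : A →⋆ₙₐ[ℂ] B)
    (φ : StrongDual ℂ B) : StrongDual ℂ A :=
  φ.comp
    { toLinearMap := (π : A →ₗ[ℂ] B)
      cont := (NonUnitalStarAlgHom.instContinuousLinearMapClassComplex.map_continuous π) }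

/-- A passage `(D, L_D, M_D, π_A, 𝔸, π_B, 𝔹)` from `X = 𝔸` to `Y = 𝔹`. -/
structure Passage {A B : Type*} [NonUnitalCStarAlgebra A] [PartialOrder A] [StarOrderedRing A]
    [NonUnitalCStarAlgebra B] [PartialOrder B] [StarOrderedRing B]
    (X : PointedProperQMS A) (Y : PointedProperQMS B)
    (D : Type*) [NonUnitalCStarAlgebra D] [PartialOrder D] [StarOrderedRing D]
    extends LipschitzTriple D where
  quantumLocallyCompact : toLipschitzTriple.IsQuantumLocallyCompact
  lsc : LowerSemicontinuousOn toLipschitzTriple.lip {d | IsSelfAdjoint d}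
  /-- the morphism onto the domain -/
  πA : D →⋆ₙₐ[ℂ] A
  /-- the morphism onto the codomain -/
  πB : D →⋆ₙₐ[ℂ] B
  topoA : IsTopographicMorphism M X.M πA
  topoB : IsTopographicMorphism M Y.M πB

namespace Passage

variable {A B D : Type*} [NonUnitalCStarAlgebra A] [PartialOrder A] [StarOrderedRing A]
  [NonUnitalCStarAlgebra B] [PartialOrder B] [StarOrderedRing B]
  [NonUnitalCStarAlgebra D] [PartialOrder D] [StarOrderedRing D]
  {X : PointedProperQMS A} {Y : PointedProperQMS B}

/-- The inverse passage. -/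
def inv (τ : Passage X Y D) : Passage Y X D where
  toLipschitzTriple := τ.toLipschitzTriple
  quantumLocallyCompact := τ.quantumLocallyCompact
  lsc := τ.lsc
  πA := τ.πB
  πB := τ.πA
  topoA := τ.topoB
  topoB := τ.topoA

/-- The lift set of `a` associated with `(l, r, ε, K)`. -/
def liftSet (τ : Passage X Y D) (a : A) (l r ε : ℝ) (K : TopologicalSpace.Compacts τ.Spec) :
    Set D :=
  {d | d ∈ τ.lipLoc K ∧ τ.πA d = a ∧ τ.πB d ∈ Y.lipBall (r + 4 * ε) ∧
    τ.lip d ≤ ENNReal.ofReal l}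

/-- The target set of `a` associated with `(l, r, ε, K)`. -/
def targetSet (τ : Passage X Y D) (a : A) (l r ε : ℝ) (K : TopologicalSpace.Compacts τ.Spec) :
    Set B :=
  τ.πB '' τ.liftSet a l r ε K

/-- `(ε, K)` is `r`-left admissible. -/
structure IsLeftAdmissible (τ : Passage X Y D) (r ε : ℝ) (K : TopologicalSpace.Compacts τ.Spec) :
    Prop where
  pos : 0 < ε
  state_subset : ∀ ψ ∈ X.stateBall r, pullback τ.πA ψ ∈ localStates τ.M K
  state_almost_subset : ∀ φ ∈ localStates τ.M K, ∃ ψ ∈ X.stateBall (r + 4 * ε),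
    τ.mkDist φ (pullback τ.πA ψ) ≤ ENNReal.ofReal ε
  target_nonempty : ∀ a ∈ X.lipBall r, (τ.targetSet a (X.lip a).toReal r ε K).Nonempty
  target_topography : ∀ a ∈ X.lipBall r, a ∈ X.M →
    (τ.targetSet a (X.lip a).toReal r ε K ∩ (Y.M : Set B)).Nonempty
  lip_le : ∀ d ∈ τ.lipLoc K, Y.lip (τ.πB d) ≤ τ.lip d

/-- `(ε, K)` is an `r`-admissible pair. -/
structure IsAdmissiblePair (τ : Passage X Y D) (r ε : ℝ) (K : TopologicalSpace.Compacts τ.Spec) :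
    Prop where
  left : τ.IsLeftAdmissible r ε K
  right : τ.inv.IsLeftAdmissible r ε K
  base : τ.specDist (fun m => X.base ⟨τ.πA m, τ.topoA.map_mem m m.2⟩)
    (fun m => Y.base ⟨τ.πB m, τ.topoB.map_mem m m.2⟩) ≤ ENNReal.ofReal ε
  jordan : ∀ d ∈ τ.lipLoc K, ∀ d' ∈ τ.lipLoc K, τ.lip (jordanProd d d') ≤
    τ.lip d * ENNReal.ofReal ‖d'‖ + τ.lip d' * ENNReal.ofReal ‖d‖
  lie : ∀ d ∈ τ.lipLoc K, ∀ d' ∈ τ.lipLoc K, τ.lip (lieProd d d') ≤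
    τ.lip d * ENNReal.ofReal ‖d'‖ + τ.lip d' * ENNReal.ofReal ‖d‖

/-- `ε` is an `r`-admissible number. -/
def IsAdmissibleNumber (τ : Passage X Y D) (r ε : ℝ) : Prop :=
  0 < ε ∧ ∃ K : ℝ → TopologicalSpace.Compacts τ.Spec,
    (∀ t ∈ Set.Ioc 0 r, ∀ t' ∈ Set.Ioc 0 r, t ≤ t' → K t ≤ K t') ∧
    ∀ t ∈ Set.Ioc 0 r, τ.IsAdmissiblePair t ε (K t)

/-- `τ` is an `r`-tunnel: some number is `r`-admissible. -/
def IsTunnel (τ : Passage X Y D) (r : ℝ) : Prop :=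
  ∃ ε : ℝ, τ.IsAdmissibleNumber r ε

end Passage

end

/-!
The elements of `D` in the corner `1_K D** 1_K` are those fixed by left and right multiplication by
every `m ∈ M` with `1_K ≤ m ≤ 1`, so they form an algebra. The norm of a self-adjoint `d` is
`|φ(d)|` for some state `φ`; if `d` is supported on `K`, then `± d ≤ ‖d‖ m` for all such `m`, which
forces `φ(m) = 1` and hence `φ(1_K) = 1`. Admissibility now provides a state `ψ` of `A` with `φ` and
`ψ ∘ π_A` at distance at most `ε`, so that a lift `d` of `a` with `L(d) ≤ l` satisfies
`‖d‖ = |φ(d)| ≤ |ψ(a)| + l ε ≤ ‖a‖ + l ε`.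

Lift sets are stable under `d + t d'`, and the choice `t = -1` turns the norm bound into the bound
on differences. With the Leibniz inequality the norm bound also controls products. Membership of
the images in the local algebras of `B` requires the balls of its topography to be compact in the
Gel'fand topology: the `L`-finite elements of `M` are dense and Lipschitz for the proper
Monge-Kantorovich metric, so the topology of that metric refines the Gel'fand topology.
-/

open scoped NNReal

section Arens

variable {A : Type*} [NonUnitalCStarAlgebra A]

theorem toBidual_injective : Function.Injective (toBidual : A → Bidual A) :=
  (NormedSpace.inclusionInDoubleDualLi (𝕜 := ℂ) (E := A)).injective

theorem toBidual_mul (a b : A) : toBidual (a * b) = bidualMul (toBidual a) (toBidual b) := rfl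

theorem bidualMul_toBidual_apply (F : Bidual A) (b : A) (f : StrongDual ℂ A) :
    bidualMul F (toBidual b) f = F (f.comp ((ContinuousLinearMap.mul ℂ A).flip b)) := rfl

theorem toBidual_bidualMul_apply (a : A) (G : Bidual A) (f : StrongDual ℂ A) :
    bidualMul (toBidual a) G f = G (f.comp (ContinuousLinearMap.mul ℂ A a)) := rfl

theorem bidualMul_assoc (F G H : Bidual A) :
    bidualMul (bidualMul F G) H = bidualMul F (bidualMul G H) := by
  ext f
  refine congrArg F (ContinuousLinearMap.ext fun a => congrArg G ?_)
  ext b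
  refine congrArg H (ContinuousLinearMap.ext fun c => ?_)
  exact congrArg f (mul_assoc a b c)

end Arens

section Characters

variable {M : Type*} [NonUnitalCStarAlgebra M]

/-- A character of a non-unital C⋆-algebra, as a ⋆-homomorphism. Mathlib knows that characters
preserve the star in the unital case, to which this reduces by extending to the unitization. -/
noncomputable def characterStarHom (χ : WeakDual.characterSpace ℂ M) : M →⋆ₙₐ[ℂ] ℂ :=
  { WeakDual.CharacterSpace.toNonUnitalAlgHom χ with
    map_star' := fun a => by
      have h := map_star (Unitization.lift (WeakDual.CharacterSpace.toNonUnitalAlgHom χ))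
        (a : Unitization ℂ M)
      rw [← Unitization.inr_star] at h
      simpa [Unitization.lift] using h }

theorem characterStarHom_apply (χ : WeakDual.characterSpace ℂ M) (a : M) :
    characterStarHom χ a = χ a := rfl

theorem norm_character_apply_le (χ : WeakDual.characterSpace ℂ M) (a : M) : ‖χ a‖ ≤ ‖a‖ :=
  NonUnitalStarAlgHom.norm_apply_le (characterStarHom χ) a

theorem character_star_mul_self (χ : WeakDual.characterSpace ℂ M) (a : M) :
    χ (star a * a) = ((‖χ a‖ ^ 2 : ℝ) : ℂ) := by
  rw [← characterStarHom_apply, map_mul, map_star, characterStarHom_apply, Complex.star_def,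
    Complex.conj_mul', Complex.ofReal_pow]

theorem continuous_character_apply (a : M) :
    Continuous fun χ : WeakDual.characterSpace ℂ M => χ a :=
  (WeakDual.eval_continuous a).comp continuous_subtype_val

theorem character_exists_one_lt_norm_apply (χ : WeakDual.characterSpace ℂ M) :
    ∃ a : M, 1 < ‖χ a‖ := by
  obtain ⟨a, ha⟩ : ∃ a : M, χ a ≠ 0 := by
    by_contra! h
    exact χ.2.1 (ContinuousLinearMap.ext h)
  refine ⟨(2 * (χ a)⁻¹) • a, ?_⟩
  rw [map_smul, smul_eq_mul, mul_assoc, inv_mul_cancel₀ ha]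
  norm_num

theorem exists_isSelfAdjoint_one_le_character {K : Set (WeakDual.characterSpace ℂ M)}
    (hK : IsCompact K) :
    ∃ h : M, IsSelfAdjoint h ∧ ∀ χ ∈ K, ∃ s : ℝ, 1 ≤ s ∧ χ h = s := by
  choose a ha using character_exists_one_lt_norm_apply (M := M)
  obtain ⟨t, ht⟩ := hK.elim_finite_subcover (fun χ => {η | 1 < ‖η (a χ)‖})
    (fun χ => isOpen_lt continuous_const (continuous_character_apply (a χ)).norm)
    (fun χ _ => Set.mem_iUnion.2 ⟨χ, ha χ⟩)
  refine ⟨∑ χ ∈ t, star (a χ) * a χ, isSelfAdjoint_sum t fun χ _ => .star_mul_self _,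
    fun η hη => ⟨∑ χ ∈ t, ‖η (a χ)‖ ^ 2, ?_, ?_⟩⟩
  · obtain ⟨χ, hχ, h1⟩ := Set.mem_iUnion₂.1 (ht hη)
    calc 1 ≤ ‖η (a χ)‖ ^ 2 := one_le_pow₀ (le_of_lt h1)
      _ ≤ _ := Finset.single_le_sum (f := fun χ => ‖η (a χ)‖ ^ 2)
        (fun _ _ => by positivity) hχ
  · rw [map_sum, Complex.ofReal_sum]
    exact Finset.sum_congr rfl fun χ _ => character_star_mul_self η (a χ)

theorem character_cfcₙ {χ : WeakDual.characterSpace ℂ M} {h : M} (hh : IsSelfAdjoint h) {s : ℝ}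
    (hs : χ h = s) {f : ℝ → ℝ} (hf : Continuous f) (hf0 : f 0 = 0) : χ (cfcₙ f h) = f s := by
  have hmap := NonUnitalStarAlgHom.map_cfcₙ (characterStarHom χ) f h hf.continuousOn hf0
    (NonUnitalStarAlgHom.instContinuousLinearMapClassComplex.map_continuous _) hh (hh.map _)
  rw [characterStarHom_apply, characterStarHom_apply, hs] at hmap
  rw [hmap, cfcₙ_eq_cfc hf.continuousOn hf0]
  exact cfc_algebraMap (A := ℂ) s f

theorem exists_norm_le_one_character_eq_one {K : Set (WeakDual.characterSpace ℂ M)}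
    (hK : IsCompact K) : ∃ y : M, ‖y‖ ≤ 1 ∧ ∀ χ ∈ K, χ y = 1 := by
  obtain ⟨h, hsa, hge⟩ := exists_isSelfAdjoint_one_le_character hK
  refine ⟨cfcₙ (fun t : ℝ => min |t| 1) h, norm_cfcₙ_le fun x _ => ?_, fun χ hχ => ?_⟩
  · rw [Real.norm_of_nonneg (le_min (abs_nonneg x) zero_le_one)]
    exact min_le_right _ _
  · obtain ⟨s, hs, hχs⟩ := hge χ hχ
    rw [character_cfcₙ hsa hχs (by fun_prop) (by simp), min_eq_right (hs.trans (le_abs_self s)),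
      Complex.ofReal_one]

theorem continuous_characterSpace_of_dense {S : Type*} [TopologicalSpace S]
    {i : S → WeakDual.characterSpace ℂ M} {Q : Set M}
    (hQ : {m | IsSelfAdjoint m} ⊆ closure Q) (hi : ∀ m ∈ Q, Continuous fun s => i s m) :
    Continuous i := by
  have hsa : ∀ m, IsSelfAdjoint m → Continuous fun s => i s m := fun m hm => by
    refine continuous_of_uniform_approx_of_continuous fun u hu => ?_
    obtain ⟨δ, hδ, hu⟩ := Metric.mem_uniformity_dist.1 hu
    obtain ⟨q, hq, hd⟩ := Metric.mem_closure_iff.1 (hQ hm) δ hδ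
    refine ⟨_, hi q hq, fun s => hu ?_⟩
    rw [dist_eq_norm, ← map_sub]
    rw [dist_eq_norm] at hd
    exact (norm_character_apply_le _ _).trans_lt hd
  refine continuous_induced_rng.2 (WeakDual.continuous_of_continuous_eval fun m => ?_)
  have hre_im : (fun s => i s m) =
      fun s => i s (realPart m : M) + Complex.I * i s (imaginaryPart m : M) := by
    ext s
    rw [← smul_eq_mul, ← map_smul, ← map_add, realPart_add_I_smul_imaginaryPart]
  change Continuous fun s => i s m
  rw [hre_im]
  exact (hsa _ (realPart m).2).add (continuous_const.mul (hsa _ (imaginaryPart m).2))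

end Characters

section IndicatorNet

variable {A : Type*} [NonUnitalCStarAlgebra A] [PartialOrder A]
  {M : NonUnitalStarSubalgebra ℂ A} {K : Set (WeakDual.characterSpace ℂ M)}

theorem IsTopography.commute_of_mem_indicatorNet (hM : IsTopography M) {m n : A}
    (hm : m ∈ indicatorNet M K) (hn : n ∈ indicatorNet M K) : Commute m n :=
  hM.comm m hm.2.2.1 n hn.2.2.1

variable [StarOrderedRing A]

theorem mul_le_left_of_commute {a b : A} (ha : 0 ≤ a) (hb : IsSelfAdjoint b) (hb1 : ‖b‖ ≤ 1)
    (hab : Commute a b) : a * b ≤ a := by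
  have hsqrt : IsSelfAdjoint (CFC.sqrt a) := .of_nonneg (CFC.sqrt_nonneg a)
  have hcomm : Commute (CFC.sqrt a) b := hab.cfcₙ_nnreal _
  calc a * b = star (CFC.sqrt a) * b * CFC.sqrt a := by
        rw [hsqrt.star_eq, mul_assoc, ← hcomm.eq, ← mul_assoc, CFC.sqrt_mul_sqrt_self a]
    _ ≤ ‖b‖ • (star (CFC.sqrt a) * CFC.sqrt a) :=
        CStarAlgebra.star_left_conjugate_le_norm_smul hb
    _ = ‖b‖ • a := by rw [hsqrt.star_eq, CFC.sqrt_mul_sqrt_self a]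
    _ ≤ (1 : ℝ) • a := smul_le_smul_of_nonneg_right hb1 ha
    _ = a := one_smul ℝ a

namespace IsTopography

theorem nonempty_indicatorNet (hM : IsTopography M) (hK : IsCompact K) :
    (indicatorNet M K).Nonempty := by
  have : IsClosed (M : Set A) := hM.isClosed
  obtain ⟨y, hy, hy1⟩ := exists_norm_le_one_character_eq_one hK
  have hnorm : ‖star y * y‖ ≤ 1 := by
    rw [CStarRing.norm_star_mul_self]
    exact mul_le_one₀ hy (norm_nonneg _) hy
  refine ⟨(star y * y : M), star_mul_self_nonneg (y : A), hnorm, (star y * y).2, fun χ hχ => ?_⟩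
  exact (character_star_mul_self χ y).trans (by simp [hy1 χ hχ])

theorem mul_mem_indicatorNet (hM : IsTopography M) {m n : A}
    (hm : m ∈ indicatorNet M K) (hn : n ∈ indicatorNet M K) : m * n ∈ indicatorNet M K := by
  obtain ⟨hm0, hm1, hmM, hmK⟩ := hm
  obtain ⟨hn0, hn1, hnM, hnK⟩ := hn
  refine ⟨Commute.mul_nonneg hm0 hn0 (hM.comm m hmM n hnM),
    (norm_mul_le _ _).trans (mul_le_one₀ hm1 (norm_nonneg _) hn1), mul_mem hmM hnM,
    fun χ hχ => ?_⟩
  exact (map_mul χ (⟨m, hmM⟩ : M) ⟨n, hnM⟩).trans (by rw [hmK χ hχ, hnK χ hχ, one_mul])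

theorem mul_le_left_of_mem_indicatorNet (hM : IsTopography M) {m n : A}
    (hm : m ∈ indicatorNet M K) (hn : n ∈ indicatorNet M K) : m * n ≤ m :=
  mul_le_left_of_commute hm.1 (.of_nonneg hn.1) hn.2.1 (hM.commute_of_mem_indicatorNet hm hn)

theorem mul_le_right_of_mem_indicatorNet (hM : IsTopography M) {m n : A}
    (hm : m ∈ indicatorNet M K) (hn : n ∈ indicatorNet M K) : m * n ≤ n := by
  rw [(hM.commute_of_mem_indicatorNet hm hn).eq]
  exact hM.mul_le_left_of_mem_indicatorNet hn hm

theorem neBot_atBot_indicatorNet (hM : IsTopography M) (hK : IsCompact K) :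
    (atBot : Filter (indicatorNet M K)).NeBot := by
  have : Nonempty (indicatorNet M K) := (hM.nonempty_indicatorNet hK).to_subtype
  have : IsCodirectedOrder (indicatorNet M K) :=
    ⟨fun m n => ⟨⟨m * n, hM.mul_mem_indicatorNet m.2 n.2⟩,
      hM.mul_le_left_of_mem_indicatorNet m.2 n.2, hM.mul_le_right_of_mem_indicatorNet m.2 n.2⟩⟩
  infer_instance

theorem tendsto_indicator_mul (hM : IsTopography M) {m : A} (hm : m ∈ indicatorNet M K)
    (f : StrongDual ℂ A) :
    Tendsto (fun n : indicatorNet M K => f (m * n)) atBot (𝓝 (indicator M K f)) := by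
  have hmul : Tendsto (fun n : indicatorNet M K =>
      (⟨m * n, hM.mul_mem_indicatorNet hm n.2⟩ : indicatorNet M K)) atBot atBot :=
    tendsto_atBot_mono (fun n => hM.mul_le_right_of_mem_indicatorNet hm n.2) tendsto_id
  exact (tendsto_indicator M K f).comp hmul

theorem toBidual_mul_indicator (hM : IsTopography M) (hK : IsCompact K) {m : A}
    (hm : m ∈ indicatorNet M K) : bidualMul (toBidual m) (indicator M K) = indicator M K := by
  have := hM.neBot_atBot_indicatorNet hK
  ext f
  rw [toBidual_bidualMul_apply]
  exact tendsto_nhds_unique (tendsto_indicator M K _) (hM.tendsto_indicator_mul hm f)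

theorem indicator_mul_toBidual (hM : IsTopography M) (hK : IsCompact K) {m : A}
    (hm : m ∈ indicatorNet M K) : bidualMul (indicator M K) (toBidual m) = indicator M K := by
  have := hM.neBot_atBot_indicatorNet hK
  ext f
  rw [bidualMul_toBidual_apply]
  refine tendsto_nhds_unique (tendsto_indicator M K _)
    ((hM.tendsto_indicator_mul hm f).congr fun n => congrArg f ?_)
  exact hM.commute_of_mem_indicatorNet hm n.2

end IsTopography

end IndicatorNet

section Supported

variable {A : Type*} [NonUnitalCStarAlgebra A]

theorem isSelfAdjoint_jordanProd {a b : A} (ha : IsSelfAdjoint a) (hb : IsSelfAdjoint b) :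
    IsSelfAdjoint (jordanProd a b) := by
  rw [IsSelfAdjoint, jordanProd, star_smul, star_add, star_mul, star_mul, ha.star_eq,
    hb.star_eq, add_comm]
  simp

theorem isSelfAdjoint_lieProd {a b : A} (ha : IsSelfAdjoint a) (hb : IsSelfAdjoint b) :
    IsSelfAdjoint (lieProd a b) := by
  rw [IsSelfAdjoint, lieProd, star_smul, star_sub, star_mul, star_mul, ha.star_eq,
    hb.star_eq, ← neg_sub (a * b), smul_neg, ← neg_smul]
  simp

theorem jordanProd_mem {S : NonUnitalSubalgebra ℂ A} {a b : A} (ha : a ∈ S) (hb : b ∈ S) :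
    jordanProd a b ∈ S :=
  SMulMemClass.smul_mem _ (add_mem (mul_mem ha hb) (mul_mem hb ha))

theorem lieProd_mem {S : NonUnitalSubalgebra ℂ A} {a b : A} (ha : a ∈ S) (hb : b ∈ S) :
    lieProd a b ∈ S :=
  SMulMemClass.smul_mem _ (sub_mem (mul_mem ha hb) (mul_mem hb ha))

theorem map_jordanProd {B F : Type*} [NonUnitalCStarAlgebra B] [FunLike F A B]
    [NonUnitalAlgHomClass F ℂ A B] (π : F) (a b : A) :
    π (jordanProd a b) = jordanProd (π a) (π b) := by
  simp only [jordanProd, map_smul, map_add, map_mul]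

theorem map_lieProd {B F : Type*} [NonUnitalCStarAlgebra B] [FunLike F A B]
    [NonUnitalAlgHomClass F ℂ A B] (π : F) (a b : A) :
    π (lieProd a b) = lieProd (π a) (π b) := by
  simp only [lieProd, map_smul, map_sub, map_mul]

variable [PartialOrder A]

/-- The subalgebra of the elements of `A` fixed by left and right multiplication by every element
of `M` lying between the indicator of `K` and `1`. It describes the corner `1_K A** 1_K ∩ A`
without reference to the bidual, see `IsTopography.corner_eq_toBidual_iff`. -/
def supportedOn (M : NonUnitalStarSubalgebra ℂ A) (K : Set (WeakDual.characterSpace ℂ M)) :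
    NonUnitalSubalgebra ℂ A where
  carrier := {a | ∀ m ∈ indicatorNet M K, m * a = a ∧ a * m = a}
  zero_mem' := fun m _ => ⟨mul_zero m, zero_mul m⟩
  add_mem' := fun {a b} ha hb m hm => by
    rw [mul_add, add_mul, (ha m hm).1, (ha m hm).2, (hb m hm).1, (hb m hm).2]
    exact ⟨rfl, rfl⟩
  mul_mem' := fun {a b} ha hb m hm => by
    rw [← mul_assoc, mul_assoc a b m, (ha m hm).1, (hb m hm).2]
    exact ⟨rfl, rfl⟩
  smul_mem' := fun c a ha m hm => by
    rw [mul_smul_comm, smul_mul_assoc, (ha m hm).1, (ha m hm).2]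
    exact ⟨rfl, rfl⟩

namespace IsTopography

variable [StarOrderedRing A] {M : NonUnitalStarSubalgebra ℂ A}
  {K : Set (WeakDual.characterSpace ℂ M)}

theorem indicator_mul_toBidual_of_mem_supportedOn (hM : IsTopography M) (hK : IsCompact K)
    {a : A} (ha : a ∈ supportedOn M K) :
    bidualMul (indicator M K) (toBidual a) = toBidual a := by
  have := hM.neBot_atBot_indicatorNet hK
  ext f
  refine tendsto_nhds_unique (tendsto_indicator M K _) (tendsto_const_nhds.congr fun m => ?_)
  exact congrArg f (ha m m.2).1.symm

theorem toBidual_mul_indicator_of_mem_supportedOn (hM : IsTopography M) (hK : IsCompact K)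
    {a : A} (ha : a ∈ supportedOn M K) :
    bidualMul (toBidual a) (indicator M K) = toBidual a := by
  have := hM.neBot_atBot_indicatorNet hK
  ext f
  refine tendsto_nhds_unique (tendsto_indicator M K _) (tendsto_const_nhds.congr fun m => ?_)
  exact congrArg f (ha m m.2).2.symm

theorem corner_eq_toBidual_iff (hM : IsTopography M) (hK : IsCompact K) {a : A} :
    corner M K a = toBidual a ↔ a ∈ supportedOn M K := by
  refine ⟨fun h m hm => ⟨toBidual_injective ?_, toBidual_injective ?_⟩, fun h => ?_⟩
  · rw [toBidual_mul, ← h, corner, ← bidualMul_assoc, ← bidualMul_assoc,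
      hM.toBidual_mul_indicator hK hm]
  · rw [toBidual_mul, ← h, corner, bidualMul_assoc, hM.indicator_mul_toBidual hK hm]
  · rw [corner, hM.indicator_mul_toBidual_of_mem_supportedOn hK h,
      hM.toBidual_mul_indicator_of_mem_supportedOn hK h]

theorem mem_localSA_iff (hM : IsTopography M) (hK : IsCompact K) {a : A} :
    a ∈ localSA M K ↔ IsSelfAdjoint a ∧ a ∈ supportedOn M K :=
  and_congr_right fun _ => hM.corner_eq_toBidual_iff hK

theorem add_smul_mem_localSA (hM : IsTopography M) (hK : IsCompact K) {a b : A}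
    (ha : a ∈ localSA M K) (hb : b ∈ localSA M K) (t : ℝ) : a + (t : ℂ) • b ∈ localSA M K := by
  rw [hM.mem_localSA_iff hK] at *
  exact ⟨ha.1.add (.smul (Complex.conj_ofReal t) hb.1),
    add_mem ha.2 (SMulMemClass.smul_mem _ hb.2)⟩

theorem neg_mem_localSA (hM : IsTopography M) (hK : IsCompact K) {a : A}
    (ha : a ∈ localSA M K) : -a ∈ localSA M K := by
  rw [hM.mem_localSA_iff hK] at *
  exact ⟨ha.1.neg, neg_mem ha.2⟩

theorem jordanProd_mem_localSA (hM : IsTopography M) (hK : IsCompact K) {a b : A}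
    (ha : a ∈ localSA M K) (hb : b ∈ localSA M K) : jordanProd a b ∈ localSA M K := by
  rw [hM.mem_localSA_iff hK] at *
  exact ⟨isSelfAdjoint_jordanProd ha.1 hb.1, jordanProd_mem ha.2 hb.2⟩

theorem lieProd_mem_localSA (hM : IsTopography M) (hK : IsCompact K) {a b : A}
    (ha : a ∈ localSA M K) (hb : b ∈ localSA M K) : lieProd a b ∈ localSA M K := by
  rw [hM.mem_localSA_iff hK] at *
  exact ⟨isSelfAdjoint_lieProd ha.1 hb.1, lieProd_mem ha.2 hb.2⟩

end IsTopography

end Supported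

section States

theorem exists_dual_apply_eq_norm_of_norm_add_eq {𝕜 E : Type*} [RCLike 𝕜]
    [NormedAddCommGroup E] [NormedSpace 𝕜 E] {x y : E} (h : ‖x + y‖ = ‖x‖ + ‖y‖) :
    ∃ f : StrongDual 𝕜 E, ‖f‖ ≤ 1 ∧ f x = ‖x‖ ∧ f y = ‖y‖ := by
  obtain ⟨f, hf, hfxy⟩ := exists_dual_vector'' 𝕜 (x + y)
  have hle : ∀ z, ‖f z‖ ≤ ‖z‖ := fun z => (f.le_of_opNorm_le hf z).trans_eq (one_mul _)
  have hre : RCLike.re (f x) + RCLike.re (f y) = ‖x‖ + ‖y‖ := by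
    rw [← map_add, ← map_add, hfxy, RCLike.ofReal_re, h]
  have hx := (RCLike.re_le_norm (f x)).trans (hle x)
  have hy := (RCLike.re_le_norm (f y)).trans (hle y)
  have hattain : ∀ z, ‖z‖ ≤ RCLike.re (f z) → f z = ‖z‖ := fun z hz => by
    have hnorm : f z = ‖f z‖ := (RCLike.norm_le_re_iff_eq_norm).1 ((hle z).trans hz)
    rw [hnorm, le_antisymm (hle z) (hz.trans (RCLike.re_le_norm _))]
  exact ⟨f, hf, hattain x (by linarith), hattain y (by linarith)⟩

section UnitalContractions

variable {U : Type*} [CStarAlgebra U] {f : StrongDual ℂ U}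

theorem norm_add_I_smul_one_sq_le [Nontrivial U] {x : U} (hx : IsSelfAdjoint x) (t : ℝ) :
    ‖x + ((t : ℂ) * Complex.I) • (1 : U)‖ ^ 2 ≤ ‖x‖ ^ 2 + t ^ 2 := by
  have hI : ((t : ℂ) * Complex.I) * ((t : ℂ) * Complex.I) = -((t ^ 2 : ℝ) : ℂ) := by
    push_cast
    linear_combination (t : ℂ) ^ 2 * Complex.I_mul_I
  have hstar : star (x + ((t : ℂ) * Complex.I) • (1 : U)) * (x + ((t : ℂ) * Complex.I) • (1 : U))
      = x * x + ((t ^ 2 : ℝ) : ℂ) • (1 : U) := by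
    have hconj : star ((t : ℂ) * Complex.I) = -((t : ℂ) * Complex.I) := by simp
    rw [star_add, star_smul, star_one, hx.star_eq, hconj, add_mul, mul_add, mul_add,
      smul_mul_smul_comm, neg_mul, hI]
    simp
  rw [sq, ← CStarRing.norm_star_mul_self, hstar]
  calc ‖x * x + ((t ^ 2 : ℝ) : ℂ) • (1 : U)‖ ≤ ‖x * x‖ + ‖((t ^ 2 : ℝ) : ℂ) • (1 : U)‖ :=
        norm_add_le _ _
    _ ≤ ‖x‖ ^ 2 + t ^ 2 := by
        rw [norm_smul, Complex.norm_real, Real.norm_of_nonneg (sq_nonneg t), norm_one, mul_one]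
        gcongr
        exact (norm_mul_le x x).trans_eq (sq ‖x‖).symm

theorem im_apply_eq_zero_of_unital_contraction (hf : ‖f‖ ≤ 1) (h1 : f 1 = 1) {x : U}
    (hx : IsSelfAdjoint x) : (f x).im = 0 := by
  have : Nontrivial U := ⟨1, 0, fun h => by simp [h] at h1⟩
  have key : ∀ t : ℝ, ((f x).im + t) ^ 2 ≤ ‖x‖ ^ 2 + t ^ 2 := fun t => by
    have him : (f x).im + t = (f (x + ((t : ℂ) * Complex.I) • (1 : U))).im := by simp [h1]
    calc ((f x).im + t) ^ 2 ≤ ‖x + ((t : ℂ) * Complex.I) • (1 : U)‖ ^ 2 := by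
          rw [him, ← sq_abs]
          gcongr
          exact (Complex.abs_im_le_norm _).trans ((f.le_of_opNorm_le hf _).trans_eq (one_mul _))
      _ ≤ ‖x‖ ^ 2 + t ^ 2 := norm_add_I_smul_one_sq_le hx t
  by_contra hne
  have hlarge := key ((‖x‖ ^ 2 + 1) / (2 * (f x).im))
  have hcancel : 2 * (f x).im * ((‖x‖ ^ 2 + 1) / (2 * (f x).im)) = ‖x‖ ^ 2 + 1 := by field_simp
  nlinarith [sq_nonneg (f x).im]

theorem re_apply_nonneg_of_unital_contraction [PartialOrder U] [StarOrderedRing U]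
    (hf : ‖f‖ ≤ 1) (h1 : f 1 = 1) {x : U} (hx : 0 ≤ x) : 0 ≤ (f x).re := by
  have hle : 0 ≤ algebraMap ℝ U ‖x‖ - x :=
    sub_nonneg.2 (IsSelfAdjoint.le_algebraMap_norm_self (.of_nonneg hx))
  have hnorm : ‖algebraMap ℝ U ‖x‖ - x‖ ≤ ‖x‖ :=
    (CStarAlgebra.norm_le_iff_le_algebraMap _ (norm_nonneg _) hle).2 (sub_le_self _ hx)
  have hfx : f (algebraMap ℝ U ‖x‖ - x) = ‖x‖ - f x := by
    rw [map_sub, Algebra.algebraMap_eq_smul_one, ← Complex.coe_smul, map_smul, h1, smul_eq_mul,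
      mul_one]
  have hre := (Complex.re_le_norm _).trans
    ((f.le_of_opNorm_le hf (algebraMap ℝ U ‖x‖ - x)).trans_eq (one_mul _))
  rw [hfx, Complex.sub_re, Complex.ofReal_re] at hre
  linarith

end UnitalContractions

theorem norm_pullback_apply_le {A B : Type*} [NonUnitalCStarAlgebra A] [NonUnitalCStarAlgebra B]
    (π : A →⋆ₙₐ[ℂ] B) {ψ : StrongDual ℂ B} (hψ : ‖ψ‖ ≤ 1) (a : A) :
    ‖pullback π ψ a‖ ≤ ‖π a‖ :=
  (ψ.le_of_opNorm_le hψ (π a)).trans_eq (one_mul _)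

variable {A : Type*} [NonUnitalCStarAlgebra A]

theorem pullback_inr_mem_stateSpace {f : StrongDual ℂ (Unitization ℂ A)} (hf : ‖f‖ ≤ 1)
    (h1 : f 1 = 1) {d : A} (hd : d ≠ 0) (hfd : ‖d‖ ≤ ‖f d‖) :
    pullback (Unitization.inrNonUnitalStarAlgHom ℂ A) f ∈ stateSpace A := by
  let _ : PartialOrder (Unitization ℂ A) := CStarAlgebra.spectralOrder _
  have : StarOrderedRing (Unitization ℂ A) := CStarAlgebra.spectralOrderedRing _
  set φ := pullback (Unitization.inrNonUnitalStarAlgHom ℂ A) f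
  have hφ : ∀ a : A, φ (star a * a) = f (star (a : Unitization ℂ A) * a) := fun a => by
    rw [← Unitization.inr_star, ← Unitization.inr_mul]
    rfl
  refine ⟨le_antisymm (φ.opNorm_le_bound zero_le_one fun a => ?_) ?_, fun a => ?_⟩
  · rw [one_mul, ← Unitization.norm_inr (𝕜 := ℂ) a]
    exact norm_pullback_apply_le _ hf a
  · exact le_of_mul_le_mul_right ((one_mul ‖d‖).trans_le (hfd.trans (φ.le_opNorm d)))
      (norm_pos_iff.2 hd)
  · rw [hφ]
    exact ⟨re_apply_nonneg_of_unital_contraction hf h1 (star_mul_self_nonneg _),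
      im_apply_eq_zero_of_unital_contraction hf h1 (.star_mul_self _)⟩

theorem exists_mem_stateSpace_apply_eq_norm {d : A} (hd : d ≠ 0)
    (hmem : ‖d‖ ∈ spectrum ℝ (d : Unitization ℂ A)) : ∃ φ ∈ stateSpace A, φ d = ‖d‖ := by
  have hnorm : ‖algebraMap ℝ (Unitization ℂ A) ‖d‖‖ = ‖d‖ := by
    rw [norm_algebraMap', norm_norm]
  -- The spectrum of `‖d‖ + d` contains `2‖d‖`, so a functional norming `‖d‖ + d` norms both terms.
  have hadd : ‖algebraMap ℝ (Unitization ℂ A) ‖d‖ + (d : Unitization ℂ A)‖ =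
      ‖algebraMap ℝ (Unitization ℂ A) ‖d‖‖ + ‖(d : Unitization ℂ A)‖ := by
    refine le_antisymm (norm_add_le _ _) ?_
    rw [hnorm, Unitization.norm_inr]
    exact (le_abs_self _).trans (spectrum.norm_le_norm_of_mem (spectrum.add_mem_add_iff.2 hmem))
  obtain ⟨f, hf, hf1, hfd⟩ := exists_dual_apply_eq_norm_of_norm_add_eq (𝕜 := ℂ) hadd
  have hunit : f 1 = 1 := by
    rw [hnorm, Algebra.algebraMap_eq_smul_one, ← Complex.coe_smul, map_smul, smul_eq_mul] at hf1
    exact mul_left_cancel₀ (Complex.ofReal_ne_zero.2 (norm_ne_zero_iff.2 hd))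
      (hf1.trans (mul_one _).symm)
  rw [Unitization.norm_inr] at hfd
  refine ⟨_, pullback_inr_mem_stateSpace hf hunit hd ?_, hfd⟩
  rw [hfd]
  simp

section LocalStates

variable [PartialOrder A] [StarOrderedRing A] {φ : StrongDual ℂ A}

open scoped ComplexOrder in
theorem apply_mono_of_mem_stateSpace (hφ : φ ∈ stateSpace A) {a b : A} (hab : a ≤ b) :
    φ a ≤ φ b := by
  obtain ⟨y, hy⟩ := CStarAlgebra.nonneg_iff_eq_star_mul_self.1 (sub_nonneg.2 hab)
  rw [← sub_nonneg, ← map_sub, hy, Complex.nonneg_iff]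
  exact ⟨(hφ.2 y).1, (hφ.2 y).2.symm⟩

namespace IsTopography

variable {M : NonUnitalStarSubalgebra ℂ A} {K : Set (WeakDual.characterSpace ℂ M)}

theorem le_norm_smul_of_mem_indicatorNet {m e : A} (hm : m ∈ indicatorNet M K)
    (he : IsSelfAdjoint e) (heK : e ∈ supportedOn M K) : e ≤ ‖e‖ • m := by
  have hmsa : IsSelfAdjoint m := .of_nonneg hm.1
  calc e = star m * e * m := by rw [hmsa.star_eq, (heK m hm).1, (heK m hm).2]
    _ ≤ ‖e‖ • (star m * m) := CStarAlgebra.star_left_conjugate_le_norm_smul he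
    _ ≤ ‖e‖ • m := by
        rw [hmsa.star_eq]
        exact smul_le_smul_of_nonneg_left
          (mul_le_left_of_commute hm.1 hmsa hm.2.1 (Commute.refl m)) (norm_nonneg e)

open scoped ComplexOrder in
theorem mem_localStates_of_apply_eq_norm (hM : IsTopography M) (hK : IsCompact K)
    (hφ : φ ∈ stateSpace A) {e : A} (he : e ∈ localSA M K) (h0 : e ≠ 0) (hφe : φ e = ‖e‖) :
    φ ∈ localStates M K := by
  have := hM.neBot_atBot_indicatorNet hK
  rw [hM.mem_localSA_iff hK] at he
  refine ⟨hφ, tendsto_nhds_unique (tendsto_indicator M K φ)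
    (tendsto_const_nhds.congr fun m => Eq.symm ?_)⟩
  have hpos : (0 : ℂ) < ‖e‖ := by exact_mod_cast norm_pos_iff.2 h0
  have hge : 1 ≤ φ m := by
    have h := apply_mono_of_mem_stateSpace hφ (le_norm_smul_of_mem_indicatorNet m.2 he.1 he.2)
    rw [← Complex.coe_smul, map_smul, smul_eq_mul, hφe] at h
    exact le_of_mul_le_mul_left ((mul_one _).trans_le h) hpos
  have hle : ‖φ m‖ ≤ 1 :=
    (φ.le_of_opNorm_le hφ.1.le _).trans ((one_mul _).trans_le m.2.2.1)
  have hnorm : φ m = ‖φ m‖ := (Complex.eq_coe_norm_of_nonneg (zero_le_one.trans hge))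
  rw [hnorm] at hge ⊢
  exact le_antisymm (by exact_mod_cast hle) hge

theorem exists_mem_localStates_norm_apply_eq (hM : IsTopography M) (hK : IsCompact K) {d : A}
    (hd : d ∈ localSA M K) (h0 : d ≠ 0) : ∃ φ ∈ localStates M K, ‖φ d‖ = ‖d‖ := by
  have hspec := CStarAlgebra.norm_or_neg_norm_mem_spectrum (hd.1.inr ℂ)
  rw [Unitization.norm_inr] at hspec
  rcases hspec with hspec | hspec
  · obtain ⟨φ, hφ, hφd⟩ := exists_mem_stateSpace_apply_eq_norm h0 hspec
    exact ⟨φ, hM.mem_localStates_of_apply_eq_norm hK hφ hd h0 hφd, by simp [hφd]⟩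
  · have hspec' : ‖-d‖ ∈ spectrum ℝ ((-d : A) : Unitization ℂ A) := by
      rwa [norm_neg, Unitization.inr_neg, ← spectrum.neg_eq]
    obtain ⟨φ, hφ, hφd⟩ := exists_mem_stateSpace_apply_eq_norm (neg_ne_zero.2 h0) hspec'
    refine ⟨φ, hM.mem_localStates_of_apply_eq_norm hK hφ (hM.neg_mem_localSA hK hd)
      (neg_ne_zero.2 h0) hφd, ?_⟩
    rw [← norm_neg (φ d), ← map_neg, hφd, Complex.norm_real, norm_norm, norm_neg]

end IsTopography

end LocalStates

end States

namespace LipschitzPair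

variable {A : Type*} [NonUnitalCStarAlgebra A] (T : LipschitzPair A)

theorem lip_smul (t : ℝ) (a : A) : T.lip ((t : ℂ) • a) = ENNReal.ofReal |t| * T.lip a :=
  (congrArg T.L (map_smul (DoubleCentralizer.coeHom (𝕜 := ℂ) (A := A)) (t : ℂ) a)).trans
    (T.smul_eq t _)

theorem lip_add_le (a b : A) : T.lip (a + b) ≤ T.lip a + T.lip b :=
  (congrArg T.L (map_add (DoubleCentralizer.coeHom (𝕜 := ℂ) (A := A)) a b)).trans_le
    (T.add_le _ _)

theorem lip_inv_smul_le_one {a : A} {l : ℝ≥0} (hl : 0 < l) (ha : T.lip a ≤ l) :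
    T.lip (((l⁻¹ : ℝ) : ℂ) • a) ≤ 1 := by
  rw [T.lip_smul, abs_of_pos (by positivity), ENNReal.ofReal_inv_of_pos (by exact_mod_cast hl),
    ENNReal.ofReal_coe_nnreal, ← ENNReal.inv_mul_cancel (by exact_mod_cast hl.ne')
    (ENNReal.coe_ne_top (r := l))]
  gcongr

theorem enorm_apply_le_mul {V : Type*} [AddCommGroup V] [Module ℂ V] (ι : V →ₗ[ℂ] A)
    (f : V →ₗ[ℂ] ℂ) {C : ℝ≥0∞} (hC : C ≠ ⊤)
    (hf : ∀ v, IsSelfAdjoint (ι v) ∧ T.lip (ι v) ≤ 1 → ‖f v‖ₑ ≤ C) {v : V}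
    (hv : IsSelfAdjoint (ι v)) {l : ℝ≥0} (hl : T.lip (ι v) ≤ l) : ‖f v‖ₑ ≤ l * C := by
  have key : ∀ s : ℝ≥0, l < s → ‖f v‖ₑ ≤ s * C := fun s hs => by
    have hs0 : 0 < s := zero_le.trans_lt hs
    have hle := hf (((s⁻¹ : ℝ) : ℂ) • v) <| by
      rw [map_smul]
      exact ⟨.smul (Complex.conj_ofReal _) hv,
        T.lip_inv_smul_le_one hs0 (hl.trans (by exact_mod_cast hs.le))⟩
    have hscale : f v = s * f (((s⁻¹ : ℝ) : ℂ) • v) := by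
      rw [map_smul, smul_eq_mul, ← mul_assoc, Complex.ofReal_inv, mul_inv_cancel₀, one_mul]
      exact_mod_cast hs0.ne'
    rw [hscale, enorm_mul]
    gcongr
    simp [enorm]
  have hlim : Tendsto (fun s : ℝ≥0 => (s : ℝ≥0∞) * C) (𝓝[>] l) (𝓝 (l * C)) :=
    (ENNReal.Tendsto.mul_const (ENNReal.tendsto_coe.2 tendsto_id) (Or.inr hC)).mono_left
      nhdsWithin_le_nhds
  exact ge_of_tendsto hlim (eventually_mem_nhdsWithin.mono key)

theorem norm_sub_le_of_mkDist_le {φ ψ : StrongDual ℂ A} {a : A} {l ε : ℝ} (hl : 0 ≤ l)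
    (hε : 0 ≤ ε) (hsa : IsSelfAdjoint a) (ha : T.lip a ≤ ENNReal.ofReal l)
    (h : T.mkDist φ ψ ≤ ENNReal.ofReal ε) : ‖φ a - ψ a‖ ≤ l * ε := by
  have hle := T.enorm_apply_le_mul LinearMap.id (φ - ψ : StrongDual ℂ A) ENNReal.ofReal_ne_top
    (fun b hb => (ofReal_norm (φ b - ψ b)).symm.trans_le
      ((le_iSup₂_of_le b hb le_rfl).trans h)) hsa (l := l.toNNReal) ha
  change ‖φ a - ψ a‖ₑ ≤ ENNReal.ofReal l * ENNReal.ofReal ε at hle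
  rwa [← ofReal_norm, ← ENNReal.ofReal_mul hl,
    ENNReal.ofReal_le_ofReal_iff (mul_nonneg hl hε)] at hle

end LipschitzPair

namespace LipschitzTriple

variable {A : Type*} [NonUnitalCStarAlgebra A] {T : LipschitzTriple A}

theorem edist_character_apply_le {χ η : T.Spec} (h : T.specDist χ η ≠ ⊤) {m : T.M} {l : ℝ≥0}
    (hsa : IsSelfAdjoint (m : A)) (hm : T.lip (m : A) ≤ l) :
    edist (χ m) (η m) ≤ l * T.specDist χ η := by
  rw [edist_eq_enorm_sub]
  exact T.enorm_apply_le_mul (NonUnitalStarSubalgebraClass.subtype T.M : T.M →ₗ[ℂ] A)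
    (χ.1 - η.1 : StrongDual ℂ T.M) h
    (fun b hb => (ofReal_norm (χ b - η b)).symm.trans_le (le_iSup₂_of_le b hb le_rfl)) hsa hm

/-- Since `T.Spec` already carries the Gel'fand topology, its Monge-Kantorovich metric is
represented by a parametrization `i` by a metric space. -/
theorem isCompact_specBall_of_edist_eq {S : Type*} [PseudoMetricSpace S] [ProperSpace S]
    {i : S → T.Spec} (hi : Function.Surjective i)
    (hdist : ∀ s t, edist s t = T.specDist (i s) (i t))
    (hdense : {a | IsSelfAdjoint a ∧ a ∈ T.M} ⊆
      closure {a | IsSelfAdjoint a ∧ T.lip a < ⊤ ∧ a ∈ T.M}) (μ : T.Spec) (R : ℝ) :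
    IsCompact (T.specBall μ R) := by
  have : IsClosed (T.M : Set A) := T.topography.isClosed
  have hcont : Continuous i := by
    refine continuous_characterSpace_of_dense
      (Q := {m : T.M | IsSelfAdjoint (m : A) ∧ T.lip (m : A) < ⊤}) (fun m hm => ?_) ?_
    · rw [closure_subtype]
      refine closure_mono ?_ (hdense (a := (m : A)) ⟨congrArg Subtype.val hm, m.2⟩)
      rintro a ⟨hsa, hlip, haM⟩
      exact ⟨⟨a, haM⟩, ⟨hsa, hlip⟩, rfl⟩
    · rintro m ⟨hsa, hlip⟩
      refine LipschitzWith.continuous (K := (T.lip (m : A)).toNNReal) fun s t => ?_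
      rw [hdist]
      exact edist_character_apply_le (hdist s t ▸ edist_ne_top s t) hsa
        (ENNReal.coe_toNNReal hlip.ne).ge
  obtain ⟨s, rfl⟩ := hi μ
  have himage : T.specBall (i s) R = i '' Metric.closedBall s (max R 0) := by
    rw [← Metric.closedEBall_ofReal (le_max_right R 0), ENNReal.ofReal_max, ENNReal.ofReal_zero,
      max_eq_left zero_le, ← Set.image_preimage_eq (T.specBall (i s) R) hi]
    congr 1
    ext t
    rw [Metric.mem_closedEBall, hdist]
    rfl
  rw [himage]
  exact (isCompact_closedBall s _).image hcont

variable [PartialOrder A] [StarOrderedRing A]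

theorem IsProperQuantum.isCompact_specBall (hT : T.IsProperQuantum) (μ : T.Spec) (R : ℝ) :
    IsCompact (T.specBall μ R) := by
  obtain ⟨m, hm, hproper⟩ := hT.proper
  refine @isCompact_specBall_of_edist_eq _ _ T T.Spec m.toPseudoMetricSpace hproper id
    Function.surjective_id hm (hT.dense_topography.trans (closure_mono ?_)) μ R
  rintro a ⟨ha, haM⟩
  obtain ⟨K, hK⟩ := Set.mem_iUnion.1 ha
  exact ⟨hK.1.1, hK.2, haM⟩

/-- The Leibniz inequalities of `T.lip` on the Lipschitz elements supported on `K`: the common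
part of the Leibniz property of a proper quantum metric space and of an admissible pair. -/
def IsLeibnizOn (T : LipschitzTriple A) (K : Set T.Spec) : Prop :=
  ∀ a ∈ T.lipLoc K, ∀ b ∈ T.lipLoc K,
    T.lip (jordanProd a b) ≤ T.lip a * ENNReal.ofReal ‖b‖ + T.lip b * ENNReal.ofReal ‖a‖ ∧
    T.lip (lieProd a b) ≤ T.lip a * ENNReal.ofReal ‖b‖ + T.lip b * ENNReal.ofReal ‖a‖

theorem IsProperQuantum.isLeibnizOn (hT : T.IsProperQuantum) (K : Set T.Spec) :
    T.IsLeibnizOn K := fun a ha b hb => by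
  rw [add_comm, mul_comm (T.lip b)]
  exact hT.leibniz a b ha.1.1 hb.1.1

section Closure

variable {K : Set T.Spec} {a b : A}

theorem add_smul_mem_lipLoc (hK : IsCompact K) (ha : a ∈ T.lipLoc K) (hb : b ∈ T.lipLoc K)
    (t : ℝ) : a + (t : ℂ) • b ∈ T.lipLoc K := by
  refine ⟨T.topography.add_smul_mem_localSA hK ha.1 hb.1 t, (T.lip_add_le _ _).trans_lt ?_⟩
  rw [T.lip_smul]
  exact ENNReal.add_lt_top.2 ⟨ha.2, ENNReal.mul_lt_top ENNReal.ofReal_lt_top hb.2⟩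

theorem leibniz_bound_lt_top (ha : a ∈ T.lipLoc K) (hb : b ∈ T.lipLoc K) :
    T.lip a * ENNReal.ofReal ‖b‖ + T.lip b * ENNReal.ofReal ‖a‖ < ⊤ :=
  ENNReal.add_lt_top.2 ⟨ENNReal.mul_lt_top ha.2 ENNReal.ofReal_lt_top,
    ENNReal.mul_lt_top hb.2 ENNReal.ofReal_lt_top⟩

theorem IsLeibnizOn.jordanProd_mem_lipLoc (hT : T.IsLeibnizOn K) (hK : IsCompact K)
    (ha : a ∈ T.lipLoc K) (hb : b ∈ T.lipLoc K) : jordanProd a b ∈ T.lipLoc K :=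
  ⟨T.topography.jordanProd_mem_localSA hK ha.1 hb.1,
    (hT a ha b hb).1.trans_lt (leibniz_bound_lt_top ha hb)⟩

theorem IsLeibnizOn.lieProd_mem_lipLoc (hT : T.IsLeibnizOn K) (hK : IsCompact K)
    (ha : a ∈ T.lipLoc K) (hb : b ∈ T.lipLoc K) : lieProd a b ∈ T.lipLoc K :=
  ⟨T.topography.lieProd_mem_localSA hK ha.1 hb.1,
    (hT a ha b hb).2.trans_lt (leibniz_bound_lt_top ha hb)⟩

end Closure

theorem norm_le_norm_map_add_mul {B : Type*} [NonUnitalCStarAlgebra B] (π : A →⋆ₙₐ[ℂ] B)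
    {K : Set T.Spec} (hK : IsCompact K) {l ε : ℝ} (hl : 0 ≤ l) (hε : 0 ≤ ε)
    (hstate : ∀ φ ∈ localStates T.M K, ∃ ψ : StrongDual ℂ B, ‖ψ‖ ≤ 1 ∧
      T.mkDist φ (pullback π ψ) ≤ ENNReal.ofReal ε)
    {d : A} (hd : d ∈ localSA T.M K) (hlip : T.lip d ≤ ENNReal.ofReal l) :
    ‖d‖ ≤ ‖π d‖ + l * ε := by
  rcases eq_or_ne d 0 with rfl | h0
  · rw [norm_zero]
    positivity
  obtain ⟨φ, hφ, hφd⟩ := T.topography.exists_mem_localStates_norm_apply_eq hK hd h0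
  obtain ⟨ψ, hψ, hmk⟩ := hstate φ hφ
  calc ‖d‖ = ‖φ d‖ := hφd.symm
    _ ≤ ‖pullback π ψ d‖ + ‖φ d - pullback π ψ d‖ := norm_le_norm_add_norm_sub' _ _
    _ ≤ ‖π d‖ + l * ε := add_le_add (norm_pullback_apply_le π hψ d)
        (T.norm_sub_le_of_mkDist_le hl hε hd.1 hlip hmk)

end LipschitzTriple

namespace Passage

variable {A B D : Type*} [NonUnitalCStarAlgebra A] [PartialOrder A] [StarOrderedRing A]
  [NonUnitalCStarAlgebra B] [PartialOrder B] [StarOrderedRing B]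
  [NonUnitalCStarAlgebra D] [PartialOrder D] [StarOrderedRing D]
  {X : PointedProperQMS A} {Y : PointedProperQMS B} {τ : Passage X Y D}
  {l r ε : ℝ} {K : TopologicalSpace.Compacts τ.Spec} {a a' : A} {d d' : D} {b b' : B}

theorem IsAdmissiblePair.isLeibnizOn (hK : τ.IsAdmissiblePair r ε K) : τ.IsLeibnizOn K :=
  fun d hd d' hd' => ⟨hK.jordan d hd d' hd', hK.lie d hd d' hd'⟩

theorem norm_le_of_mem_liftSet (hK : τ.IsLeftAdmissible r ε K) (hl : 0 ≤ l)
    (hd : d ∈ τ.liftSet a l r ε K) : ‖d‖ ≤ ‖a‖ + l * ε := by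
  obtain ⟨hloc, rfl, -, hlip⟩ := hd
  refine LipschitzTriple.norm_le_norm_map_add_mul τ.πA K.isCompact hl hK.pos.le
    (fun φ hφ => ?_) hloc.1 hlip
  obtain ⟨ψ, hψ, hmk⟩ := hK.state_almost_subset φ hφ
  exact ⟨ψ, hψ.1.1.le, hmk⟩

theorem add_smul_mem_liftSet (hl : 0 ≤ l) (hd : d ∈ τ.liftSet a l r ε K)
    (hd' : d' ∈ τ.liftSet a' l r ε K) (t : ℝ) :
    d + (t : ℂ) • d' ∈ τ.liftSet (a + (t : ℂ) • a') ((1 + |t|) * l) r ε K := by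
  obtain ⟨hloc, rfl, hB, hlip⟩ := hd
  obtain ⟨hloc', rfl, hB', hlip'⟩ := hd'
  refine ⟨LipschitzTriple.add_smul_mem_lipLoc K.isCompact hloc hloc' t, by rw [map_add, map_smul],
    ?_, ?_⟩
  · rw [map_add, map_smul]
    exact LipschitzTriple.add_smul_mem_lipLoc (Y.isProper.isCompact_specBall _ _) hB hB' t
  · refine (τ.lip_add_le _ _).trans ?_
    rw [τ.lip_smul, add_mul, one_mul, ENNReal.ofReal_add hl (by positivity),
      ENNReal.ofReal_mul (abs_nonneg t)]
    gcongr

theorem leibniz_bound_le_of_mem_liftSet (hK : τ.IsLeftAdmissible r ε K) (hl : 0 ≤ l)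
    (hd : d ∈ τ.liftSet a l r ε K) (hd' : d' ∈ τ.liftSet a' l r ε K) :
    τ.lip d * ENNReal.ofReal ‖d'‖ + τ.lip d' * ENNReal.ofReal ‖d‖ ≤
      ENNReal.ofReal (l * (‖a‖ + ‖a'‖ + 2 * l * ε)) := by
  have hε := hK.pos
  calc τ.lip d * ENNReal.ofReal ‖d'‖ + τ.lip d' * ENNReal.ofReal ‖d‖
      ≤ ENNReal.ofReal l * ENNReal.ofReal (‖a'‖ + l * ε) +
        ENNReal.ofReal l * ENNReal.ofReal (‖a‖ + l * ε) := by
        gcongr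
        exacts [hd.2.2.2, norm_le_of_mem_liftSet hK hl hd', hd'.2.2.2,
          norm_le_of_mem_liftSet hK hl hd]
    _ = ENNReal.ofReal (l * (‖a‖ + ‖a'‖ + 2 * l * ε)) := by
        rw [← ENNReal.ofReal_mul hl, ← ENNReal.ofReal_mul hl,
          ← ENNReal.ofReal_add (by positivity) (by positivity)]
        ring_nf

theorem jordanProd_mem_liftSet (hK : τ.IsLeftAdmissible r ε K) (hLeib : τ.IsLeibnizOn K)
    (hl : 0 ≤ l) (hd : d ∈ τ.liftSet a l r ε K) (hd' : d' ∈ τ.liftSet a' l r ε K) :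
    jordanProd d d' ∈ τ.liftSet (jordanProd a a') (l * (‖a‖ + ‖a'‖ + 2 * l * ε)) r ε K := by
  have hlip := (hLeib d hd.1 d' hd'.1).1.trans (leibniz_bound_le_of_mem_liftSet hK hl hd hd')
  obtain ⟨hloc, rfl, hB, -⟩ := hd
  obtain ⟨hloc', rfl, hB', -⟩ := hd'
  refine ⟨hLeib.jordanProd_mem_lipLoc K.isCompact hloc hloc', map_jordanProd _ _ _, ?_, hlip⟩
  rw [map_jordanProd]
  exact (Y.isProper.isLeibnizOn _).jordanProd_mem_lipLoc (Y.isProper.isCompact_specBall _ _) hB hB'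

theorem lieProd_mem_liftSet (hK : τ.IsLeftAdmissible r ε K) (hLeib : τ.IsLeibnizOn K)
    (hl : 0 ≤ l) (hd : d ∈ τ.liftSet a l r ε K) (hd' : d' ∈ τ.liftSet a' l r ε K) :
    lieProd d d' ∈ τ.liftSet (lieProd a a') (l * (‖a‖ + ‖a'‖ + 2 * l * ε)) r ε K := by
  have hlip := (hLeib d hd.1 d' hd'.1).2.trans (leibniz_bound_le_of_mem_liftSet hK hl hd hd')
  obtain ⟨hloc, rfl, hB, -⟩ := hd
  obtain ⟨hloc', rfl, hB', -⟩ := hd'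
  refine ⟨hLeib.lieProd_mem_lipLoc K.isCompact hloc hloc', map_lieProd _ _ _, ?_, hlip⟩
  rw [map_lieProd]
  exact (Y.isProper.isLeibnizOn _).lieProd_mem_lipLoc (Y.isProper.isCompact_specBall _ _) hB hB'

theorem norm_le_of_mem_targetSet (hK : τ.IsLeftAdmissible r ε K) (hl : 0 ≤ l)
    (hb : b ∈ τ.targetSet a l r ε K) : ‖b‖ ≤ ‖a‖ + l * ε := by
  obtain ⟨d, hd, rfl⟩ := hb
  exact (NonUnitalStarAlgHom.norm_apply_le τ.πB d).trans (norm_le_of_mem_liftSet hK hl hd)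

theorem add_smul_mem_targetSet (hl : 0 ≤ l) (hb : b ∈ τ.targetSet a l r ε K)
    (hb' : b' ∈ τ.targetSet a' l r ε K) (t : ℝ) :
    b + (t : ℂ) • b' ∈ τ.targetSet (a + (t : ℂ) • a') ((1 + |t|) * l) r ε K := by
  obtain ⟨d, hd, rfl⟩ := hb
  obtain ⟨d', hd', rfl⟩ := hb'
  exact ⟨_, add_smul_mem_liftSet hl hd hd' t, by rw [map_add, map_smul]⟩

theorem norm_sub_le_of_mem_targetSet (hK : τ.IsLeftAdmissible r ε K) (hl : 0 ≤ l)
    (hb : b ∈ τ.targetSet a l r ε K) (hb' : b' ∈ τ.targetSet a' l r ε K) :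
    ‖b - b'‖ ≤ ‖a - a'‖ + 2 * l * ε := by
  have hdiff := add_smul_mem_targetSet hl hb hb' (-1)
  have htwo : 1 + |(-1 : ℝ)| = 2 := by norm_num
  have hnorm := norm_le_of_mem_targetSet hK (by positivity) hdiff
  simpa only [htwo, Complex.ofReal_neg, Complex.ofReal_one, neg_one_smul, ← sub_eq_add_neg]
    using hnorm

theorem ediam_targetSet_le (hK : τ.IsLeftAdmissible r ε K) (hl : 0 ≤ l) :
    Metric.ediam (τ.targetSet a l r ε K) ≤ ENNReal.ofReal (2 * l * ε) := by
  refine Metric.ediam_le fun b hb b' hb' => ?_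
  rw [edist_dist, dist_eq_norm]
  refine ENNReal.ofReal_le_ofReal ((norm_sub_le_of_mem_targetSet hK hl hb hb').trans_eq ?_)
  rw [sub_self, norm_zero, zero_add]

theorem jordanProd_mem_targetSet (hK : τ.IsLeftAdmissible r ε K) (hLeib : τ.IsLeibnizOn K)
    (hl : 0 ≤ l) (hb : b ∈ τ.targetSet a l r ε K) (hb' : b' ∈ τ.targetSet a' l r ε K) :
    jordanProd b b' ∈ τ.targetSet (jordanProd a a') (l * (‖a‖ + ‖a'‖ + 2 * l * ε)) r ε K := by
  obtain ⟨d, hd, rfl⟩ := hb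
  obtain ⟨d', hd', rfl⟩ := hb'
  exact ⟨_, jordanProd_mem_liftSet hK hLeib hl hd hd', map_jordanProd _ _ _⟩

theorem lieProd_mem_targetSet (hK : τ.IsLeftAdmissible r ε K) (hLeib : τ.IsLeibnizOn K)
    (hl : 0 ≤ l) (hb : b ∈ τ.targetSet a l r ε K) (hb' : b' ∈ τ.targetSet a' l r ε K) :
    lieProd b b' ∈ τ.targetSet (lieProd a a') (l * (‖a‖ + ‖a'‖ + 2 * l * ε)) r ε K := by
  obtain ⟨d, hd, rfl⟩ := hb
  obtain ⟨d', hd', rfl⟩ := hb'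
  exact ⟨_, lieProd_mem_liftSet hK hLeib hl hd hd', map_lieProd _ _ _⟩

end Passage

theorem mainTheorem4_general {A B D : Type*}
    [NonUnitalCStarAlgebra A] [PartialOrder A] [StarOrderedRing A]
    [NonUnitalCStarAlgebra B] [PartialOrder B] [StarOrderedRing B]
    [NonUnitalCStarAlgebra D] [PartialOrder D] [StarOrderedRing D]
    {X : PointedProperQMS A} {Y : PointedProperQMS B} {τ : Passage X Y D}
    {r l : ℝ} (hl : 0 ≤ l) {ε : ℝ} {K : TopologicalSpace.Compacts τ.Spec}
    (hK : τ.IsLeftAdmissible r ε K) (hLeib : τ.IsLeibnizOn K) (a a' : A) :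
    (∀ d ∈ τ.liftSet a l r ε K, ‖d‖ ≤ ‖a‖ + l * ε) ∧
    (∀ b ∈ τ.targetSet a l r ε K, ‖b‖ ≤ ‖a‖ + l * ε) ∧
    (∀ b ∈ τ.targetSet a l r ε K, ∀ b' ∈ τ.targetSet a' l r ε K, ∀ t : ℝ,
      b + (t : ℂ) • b' ∈ τ.targetSet (a + (t : ℂ) • a') ((1 + |t|) * l) r ε K) ∧
    (⨆ (b : B) (_ : b ∈ τ.targetSet a l r ε K) (b' : B) (_ : b' ∈ τ.targetSet a' l r ε K),
      ENNReal.ofReal ‖b - b'‖) ≤ ENNReal.ofReal (‖a - a'‖ + 2 * l * ε) ∧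
    Metric.ediam (τ.targetSet a l r ε K) ≤ ENNReal.ofReal (2 * l * ε) ∧
    (∀ b ∈ τ.targetSet a l r ε K, ∀ b' ∈ τ.targetSet a' l r ε K,
      jordanProd b b' ∈
        τ.targetSet (jordanProd a a') (l * (‖a‖ + ‖a'‖ + 2 * l * ε)) r ε K ∧
      lieProd b b' ∈
        τ.targetSet (lieProd a a') (l * (‖a‖ + ‖a'‖ + 2 * l * ε)) r ε K) :=
  ⟨fun _ hd => Passage.norm_le_of_mem_liftSet hK hl hd,
    fun _ hb => Passage.norm_le_of_mem_targetSet hK hl hb,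
    fun _ hb _ hb' t => Passage.add_smul_mem_targetSet hl hb hb' t,
    iSup₂_le fun _ hb => iSup₂_le fun _ hb' =>
      ENNReal.ofReal_le_ofReal (Passage.norm_sub_le_of_mem_targetSet hK hl hb hb'),
    Passage.ediam_targetSet_le hK hl,
    fun _ hb _ hb' => ⟨Passage.jordanProd_mem_targetSet hK hLeib hl hb hb',
      Passage.lieProd_mem_targetSet hK hLeib hl hb hb'⟩⟩

theorem mainTheorem4 {A B D : Type*}
    [NonUnitalCStarAlgebra A] [PartialOrder A] [StarOrderedRing A]
    [NonUnitalCStarAlgebra B] [PartialOrder B] [StarOrderedRing B]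
    [NonUnitalCStarAlgebra D] [PartialOrder D] [StarOrderedRing D]
    (X : PointedProperQMS A) (Y : PointedProperQMS B) (τ : Passage X Y D)
    (r : ℝ) (hr : 0 < r) (hτ : τ.IsTunnel r) (l : ℝ) (hl : 0 ≤ l)
    (ε : ℝ) (K : TopologicalSpace.Compacts τ.Spec) (hK : τ.IsAdmissiblePair r ε K) :
    (∀ a ∈ X.lipBall r, X.lip a ≤ ENNReal.ofReal l →
      (∀ d ∈ τ.liftSet a l r ε K, ‖d‖ ≤ ‖a‖ + l * ε) ∧
      (∀ b ∈ τ.targetSet a l r ε K, ‖b‖ ≤ ‖a‖ + l * ε)) ∧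
    (∀ a ∈ X.lipBall r, ∀ a' ∈ X.lipBall r,
      X.lip a ≤ ENNReal.ofReal l → X.lip a' ≤ ENNReal.ofReal l →
      ∀ b ∈ τ.targetSet a l r ε K, ∀ b' ∈ τ.targetSet a' l r ε K, ∀ t : ℝ,
        b + (t : ℂ) • b' ∈ τ.targetSet (a + (t : ℂ) • a') ((1 + |t|) * l) r ε K) ∧
    (∀ a ∈ X.lipBall r, ∀ a' ∈ X.lipBall r,
      X.lip a ≤ ENNReal.ofReal l → X.lip a' ≤ ENNReal.ofReal l →
      (⨆ (b : B) (_ : b ∈ τ.targetSet a l r ε K) (b' : B) (_ : b' ∈ τ.targetSet a' l r ε K),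
        ENNReal.ofReal ‖b - b'‖) ≤ ENNReal.ofReal (‖a - a'‖ + 2 * l * ε)) ∧
    (∀ a ∈ X.lipBall r, X.lip a ≤ ENNReal.ofReal l →
      Metric.ediam (τ.targetSet a l r ε K) ≤ ENNReal.ofReal (2 * l * ε)) ∧
    (∀ a ∈ X.lipBall r, ∀ a' ∈ X.lipBall r,
      X.lip a ≤ ENNReal.ofReal l → X.lip a' ≤ ENNReal.ofReal l →
      ∀ b ∈ τ.targetSet a l r ε K, ∀ b' ∈ τ.targetSet a' l r ε K,
        jordanProd b b' ∈
          τ.targetSet (jordanProd a a') (l * (‖a‖ + ‖a'‖ + 2 * l * ε)) r ε K ∧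
        lieProd b b' ∈
          τ.targetSet (lieProd a a') (l * (‖a‖ + ‖a'‖ + 2 * l * ε)) r ε K) := by
  have hmain := mainTheorem4_general hl hK.left hK.isLeibnizOn
  exact ⟨fun a _ _ => ⟨(hmain a a).1, (hmain a a).2.1⟩,
    fun a _ a' _ _ _ => (hmain a a').2.2.1, fun a _ a' _ _ _ => (hmain a a').2.2.2.1,
    fun a _ _ => (hmain a a).2.2.2.2.1, fun a _ a' _ _ _ => (hmain a a').2.2.2.2.2⟩
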